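/- Fix $t_0<T$, $x_0\in\mathbb R^n$, a set $V\subset\mathbb R^m$, finite index sets $E,I$, and functions $f:\mathbb R^n\times\mathbb R^m\times\mathbb R\to\mathbb R^n$ and $\Phi^0,\Phi^k:\mathbb R^n\times\mathbb R\to\mathbb R$ ($k\in E\cup I$). Assume that $f$ is continuous and has partial derivatives $f_x,f_u$ that are continuous in all arguments, and that $\Phi^0(\cdot,T),\Phi^k(\cdot,T)$ are $C^1$. Let $X$ be the set of pairs $(z,u)$ of piecewise continuous functions on $[t_0,T]$, with values in $\mathbb R^n$ and $\mathbb R^m$, such that $u(t)\in V$ for all $t$; with $(z,u)$ associate the state $x(t)=x_0+\int_{t_0}^t z$ (so $z=\dot x$). Let $\Omega\subset X$ be the set of admissible pairs: $\dot x=f(x,u,t)$ almost everywhere, $\Phi^k(x(T),T)=0$ for $k\in E$, and $\Phi^k(x(T),T)\le 0$ for $k\in I$. Put $J=\Phi^0(x(T),T)$ and $$\varphi_{\rm diff}=\Big(\int_{t_0}^T|z-f(x,u,t)|^2dt\Big)^{1/2},\quad \varphi_{\rm term}=\max_{k\in E,\,j\in I}\{0,|\Phi^k(x(T),T)|,\Phi^j(x(T),T)\},\quad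 \varphi=\varphi_{\rm diff}+\varphi_{\rm term},\quad F_\lambda=J+\lambda\varphi .$$ A number $\lambda\ge0$ is an exact penalty constant if $\inf_XF_\lambda=\inf_\Omega J$. A direction at $w\in X$ is an $h$ with $w+\varepsilon h\in X$ for all small $\varepsilon\ge0$, and $\partial\varphi(w)$ is the set of $p\in L^2$ with $\langle p,h\rangle\le\liminf_{\varepsilon\downarrow0}(\varphi(w+\varepsilon h)-\varphi(w))/\varepsilon$ for all directions $h$ at $w$. The unified separation condition (USC) says: there are $a,\delta>0$ with $\operatorname{dist}_{L^2}(0,\partial\varphi(w))\ge a$ for all $w\in X$ with $0<\varphi(w)<\delta$. Let $(x^*,u^*)$, with $z^*=\dot x^*$, be an admissible pair. (1) Suppose that the USC holds, $V$ is convex, $J$ is bounded below on $X$, $F_\lambda$ attains its minimum on $X$ for all large $\lambda$, and, for some $\delta>0$, $J$ is $L^2$-Lipschitz on $\{w\in X:0<\varphi(w)<\delta\}$. If $(x^*,u^*)$ is optimal (it minimizes $J$ on $\Omega$), then there is an exact penalty constant $\lambda_1$ such that every $\lambda>\lambda_1$ is an exact penalty constant and $(x^*,u^*)$ is a global, hence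 local, minimizer of $F_\lambda$ on $X$. (2) Let $\lambda\ge0$ be such that $(x^*,u^*)$ is a local minimizer of $F_\lambda$ on $X$ (with respect to uniform closeness of $z$ and $u$). Then there are a continuous $s^*:[t_0,T]\to\mathbb R^n$ with $\|s^*\|_{L^2}\le1$ and numbers $\nu_k\in[-\lambda,\lambda]$ ($k\in E$), $\mu_k\in[0,\lambda]$ ($k\in I$), with $\mu_k\Phi^k(x^*(T),T)=0$ for $k\in I$, such that $\psi=\lambda s^*$ satisfies $$\dot\psi(t)=-f_x(x^*(t),u^*(t),t)^T\psi(t)$$ at every continuity point $t$ of $u^*$ in $[t_0,T]$ (one-sided at $t_0$ and $T$), and $$f_u(x^*(t),u^*(t),t)^T\psi(t)=0$$ at every such $t$ with $u^*(t)$ in the interior of $V$ (so at all of them if $V=\mathbb R^m$), and $$\psi(T)=-\frac{\partial\Phi^0}{\partial x}-\sum_{k\in E}\nu_k\frac{\partial\Phi^k}{\partial x}-\sum_{k\in I}\mu_k\frac{\partial\Phi^k}{\partial x}\quad\text{at }(x^*(T),T).$$ If the endpoint is free ($E=I=\emptyset$), then $\psi(T)=-\frac{\partial\Phi^0}{\partial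 x}(x^*(T),T)$. -/

import Mathlib

open Set Filter Topology MeasureTheory

noncomputable section

/-- `ℝⁿ` with its Euclidean norm. -/
abbrev Vec (n : ℕ) : Type := EuclideanSpace ℝ (Fin n)

/-- Pairs `(z, u)`: `z = x'` is the velocity of the state and `u` is the control. -/
abbrev VelCtrl (n m : ℕ) : Type := (ℝ → Vec n) × (ℝ → Vec m)

/-- Piecewise continuity on `[a, b]`: continuity off a finite set, and finite one-sided limits. -/
def PiecewiseContinuous {k : ℕ} (g : ℝ → Vec k) (a b : ℝ) : Prop :=
  (∃ S : Finset ℝ, ∀ t ∈ Icc a b, t ∉ S → ContinuousWithinAt g (Icc a b) t) ∧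
  (∀ t ∈ Ioc a b, ∃ l : Vec k, Tendsto g (𝓝[<] t) (𝓝 l)) ∧
  (∀ t ∈ Ico a b, ∃ l : Vec k, Tendsto g (𝓝[>] t) (𝓝 l))

/-- The data of a Mayer problem on the fixed interval `[t₀, T]`: minimize `Φ₀ (x T) T` subject to
`x' = f x u t`, `x t₀ = x₀`, `u t ∈ V`, `ΦE k (x T) T = 0` for `k : E` and `ΦI j (x T) T ≤ 0` for
`j : I`. -/
structure MayerProblem (n m : ℕ) (E I : Type*) where
  t₀ : ℝ
  T : ℝ
  x₀ : Vec n
  V : Set (Vec m)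
  f : Vec n → Vec m → ℝ → Vec n
  Φ₀ : Vec n → ℝ → ℝ
  ΦE : E → Vec n → ℝ → ℝ
  ΦI : I → Vec n → ℝ → ℝ

namespace MayerProblem

variable {n m : ℕ} {E I : Type*} (P : MayerProblem n m E I)

/-- The Jacobian `∂f/∂x`. -/
def fx (x : Vec n) (u : Vec m) (t : ℝ) : Vec n →L[ℝ] Vec n :=
  fderiv ℝ (fun y => P.f y u t) x

/-- The Jacobian `∂f/∂u`. -/
def fu (x : Vec n) (u : Vec m) (t : ℝ) : Vec m →L[ℝ] Vec n :=
  fderiv ℝ (fun v => P.f x v t) u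

/-- Standing regularity: `f` is continuous in all arguments and has partial derivatives in `x` and
in `u` that are continuous in all arguments; the terminal functions are continuously
differentiable in the state at the terminal time. -/
structure Regular : Prop where
  t₀_lt_T : P.t₀ < P.T
  continuous_f : Continuous fun p : Vec n × Vec m × ℝ => P.f p.1 p.2.1 p.2.2
  differentiable_x : ∀ u t, Differentiable ℝ fun y => P.f y u t
  differentiable_u : ∀ x t, Differentiable ℝ fun v => P.f x v t
  continuous_fx : Continuous fun p : Vec n × Vec m × ℝ => P.fx p.1 p.2.1 p.2.2
  continuous_fu : Continuous fun p : Vec n × Vec m × ℝ => P.fu p.1 p.2.1 p.2.2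
  contDiff_Φ₀ : ContDiff ℝ 1 fun y => P.Φ₀ y P.T
  contDiff_ΦE : ∀ k, ContDiff ℝ 1 fun y => P.ΦE k y P.T
  contDiff_ΦI : ∀ j, ContDiff ℝ 1 fun y => P.ΦI j y P.T

/-- The trajectory `x t = x₀ + ∫_{t₀}^t z`. -/
def traj (z : ℝ → Vec n) (t : ℝ) : Vec n :=
  P.x₀ + ∫ τ in P.t₀..t, z τ

/-- The space `X` on which the penalty function lives: `z` and `u` are piecewise continuous and
independent of each other, and `u` takes its values in `V`. -/
def domain : Set (VelCtrl n m) :=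
  {w | PiecewiseContinuous w.1 P.t₀ P.T ∧ PiecewiseContinuous w.2 P.t₀ P.T ∧
    ∀ t ∈ Icc P.t₀ P.T, w.2 t ∈ P.V}

/-- The admissible set `Ω`: state equation and terminal constraints hold. -/
def admissible : Set (VelCtrl n m) :=
  {w | w ∈ P.domain ∧
    (∀ᵐ t ∂(volume.restrict (Icc P.t₀ P.T)), w.1 t = P.f (P.traj w.1 t) (w.2 t) t) ∧
    (∀ k, P.ΦE k (P.traj w.1 P.T) P.T = 0) ∧
    (∀ j, P.ΦI j (P.traj w.1 P.T) P.T ≤ 0)}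

/-- The cost. -/
def J (w : VelCtrl n m) : ℝ := P.Φ₀ (P.traj w.1 P.T) P.T

/-- The `L²` norm of the defect in the state equation. -/
def phiDiff (w : VelCtrl n m) : ℝ :=
  Real.sqrt (∫ t in P.t₀..P.T, ‖w.1 t - P.f (P.traj w.1 t) (w.2 t) t‖ ^ 2)

/-- The terminal penalty: the largest of `0`, the `|ΦE k|` and the `ΦI j` at the endpoint. -/
def phiTerm (w : VelCtrl n m) : ℝ :=
  max 0 (⨆ i : E ⊕ I, Sum.elim (fun k => |P.ΦE k (P.traj w.1 P.T) P.T|)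
    (fun j => P.ΦI j (P.traj w.1 P.T) P.T) i)

/-- The penalty term `φ`. -/
def phi (w : VelCtrl n m) : ℝ := P.phiDiff w + P.phiTerm w

/-- The penalty function `F_lam`. -/
def F (lam : ℝ) (w : VelCtrl n m) : ℝ := P.J w + lam * P.phi w

/-- A (global) solution of the constrained problem. -/
def IsOptimal (w : VelCtrl n m) : Prop :=
  w ∈ P.admissible ∧ ∀ w' ∈ P.admissible, P.J w ≤ P.J w'

/-- `lam ≥ 0` is an exact penalty constant: `inf_X F_lam = inf_Ω J` (infima in `[-∞, ∞]`). -/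
def IsExactPenaltyConstant (lam : ℝ) : Prop :=
  0 ≤ lam ∧
    (⨅ w ∈ P.domain, ((P.F lam w : ℝ) : EReal)) = ⨅ w ∈ P.admissible, ((P.J w : ℝ) : EReal)

/-- `w` is a local minimizer of `F_lam` on `X` with respect to uniform closeness of velocities and
controls (a weak local minimizer). Every local minimizer in a coarser topology, such as that of
`L²`, is one. -/
def IsLocalMinimizer (lam : ℝ) (w : VelCtrl n m) : Prop :=
  w ∈ P.domain ∧ ∃ r > 0, ∀ w' ∈ P.domain,
    (∀ t ∈ Icc P.t₀ P.T, ‖w'.1 t - w.1 t‖ < r ∧ ‖w'.2 t - w.2 t‖ < r) → P.F lam w ≤ P.F lam w'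

/-- The `L²` norm of a pair. -/
def normL2 (w : VelCtrl n m) : ℝ :=
  Real.sqrt (∫ t in P.t₀..P.T, (‖w.1 t‖ ^ 2 + ‖w.2 t‖ ^ 2))

/-- The `L²` pairing. -/
def pairing (p h : VelCtrl n m) : ℝ :=
  ∫ t in P.t₀..P.T, (inner ℝ (p.1 t) (h.1 t) + inner ℝ (p.2 t) (h.2 t))

/-- Directions along which one can leave `w` without leaving `X`. -/
def directions (w : VelCtrl n m) : Set (VelCtrl n m) :=
  {h | ∃ ε₀ > 0, ∀ ε ∈ Icc (0 : ℝ) ε₀, w + ε • h ∈ P.domain}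

/-- The subdifferential of `φ : X → ℝ` at `w`: the `p` in `L²` with
`⟨p, h⟩ ≤ φ'(w; h) = liminf_{ε ↓ 0} (φ (w + ε h) - φ w) / ε` for all directions `h`. -/
def subdiffPhi (w : VelCtrl n m) : Set (VelCtrl n m) :=
  {p | MemLp p.1 2 (volume.restrict (Icc P.t₀ P.T)) ∧
    MemLp p.2 2 (volume.restrict (Icc P.t₀ P.T)) ∧
    ∀ h ∈ P.directions w, ∀ c < P.pairing p h,
      ∀ᶠ ε : ℝ in 𝓝[>] 0, c ≤ (P.phi (w + ε • h) - P.phi w) / ε}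

/-- The Unified Separation Condition: `dist (0, ∂φ) ≥ a > 0` at all points outside `Ω` of a
neighbourhood `{φ < δ}` of `Ω`. -/
def USC : Prop :=
  ∃ a > 0, ∃ δ > 0, ∀ w ∈ P.domain, 0 < P.phi w → P.phi w < δ →
    ∀ p ∈ P.subdiffPhi w, a ≤ P.normL2 p

/-- The cost is bounded below on `X`. -/
def CostBoundedBelow : Prop := ∃ c : ℝ, ∀ w ∈ P.domain, c ≤ P.J w

/-- For all large `lam` the function `F_lam` attains its infimum on `X`. -/
def PenaltyAttained : Prop :=
  ∃ lam₀ : ℝ, ∀ lam ≥ lam₀, ∃ w ∈ P.domain, ∀ w' ∈ P.domain, P.F lam w ≤ P.F lam w'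

/-- The cost is Lipschitz in `L²` on `{0 < φ < δ}` for some `δ > 0`. -/
def CostLipschitz : Prop :=
  ∃ δ > 0, ∃ L : ℝ, ∀ w ∈ P.domain, ∀ w' ∈ P.domain,
    0 < P.phi w → P.phi w < δ → 0 < P.phi w' → P.phi w' < δ →
      |P.J w - P.J w'| ≤ L * P.normL2 (w - w')

end MayerProblem

end

/-! Both halves rest on one fact: the penalty term φ is a convex function composed with a map that
is differentiable along variations. The map sends a pair to its defect in L² together with its
terminal constraint values (`penaltyState`); the convex function is a norm plus a maximum
(`penaltyNorm`). The defect expands to first order uniformly in time, so up to o(ε) the value φ(w +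
εh) is `penaltyNorm` at the linearized state (`eventually_abs_phi_sub_le`).

Exactness. At a minimizer w of F_λ with 0 < φ(w) < δ, the Lipschitz bound on J forces the
directional derivatives of φ to be at least -(L/λ)‖h‖. Convexity of V makes the directions a convex
cone, and separating the region below the graph of -(L/λ)‖·‖ from the cone above the directional
derivatives gives a subgradient of norm at most L/λ (`exists_subgradient_of_cone`,
`exists_mem_subdiffPhi`). For large λ this contradicts the separation condition, while the lower
bound on J forces φ(w) < δ. Hence minimizers of F_λ are admissible (`phi_eq_zero_of_minimizer`), and
an optimal pair, which costs no more, minimizes F_λ as well.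

Multipliers. At an admissible local minimizer the first variation is nonnegative on a linear space
of variations, that is, minus the derivative of J is dominated by λ times a sublinear function of
the linearized defect and constraints. A Hahn-Banach extension splits into components σ, ν, μ, whose
bounds and signs are read off from the dominating function (`exists_multipliers`). Varying the
velocity alone gives a weak adjoint equation for σ; by the du Bois-Reymond lemma σ agrees almost
everywhere with a continuous ψ, which satisfies the differential equation and the transversality
condition (`exists_adjoint_solution`). Varying the control alone by bumps gives stationarity
(`adjoint_fu_apply_eq_zero`). -/

noncomputable section

/-! ### Sublinearity of the terminal maximum. -/

section MaxPos

/-- The largest of `0`, the `|e k|` and the `i j`. -/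
def posMax {E I : Type*} (e : E → ℝ) (i : I → ℝ) : ℝ :=
  max 0 (⨆ l : E ⊕ I, Sum.elim (fun k => |e k|) i l)

theorem posMax_nonneg {E I : Type*} (e : E → ℝ) (i : I → ℝ) : 0 ≤ posMax e i := le_max_left _ _

variable {E I : Type*} [Fintype E] [Fintype I]

theorem posMax_le_iff {e : E → ℝ} {i : I → ℝ} {θ : ℝ} :
    posMax e i ≤ θ ↔ 0 ≤ θ ∧ (∀ k, |e k| ≤ θ) ∧ ∀ j, i j ≤ θ := by
  unfold posMax
  rw [max_le_iff]
  refine and_congr_right fun h0 => ?_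
  constructor
  · intro h
    have hb : BddAbove (range (Sum.elim (fun k => |e k|) i)) := (finite_range _).bddAbove
    exact ⟨fun k => (le_ciSup hb (Sum.inl k)).trans h, fun j => (le_ciSup hb (Sum.inr j)).trans h⟩
  · rintro ⟨h1, h2⟩
    -- A real supremum over an empty index type is `0`, so `0 ≤ θ` also covers the case of no
    -- constraints.
    exact Real.iSup_le (by rintro (k | j) <;> simp [h1, h2]) h0

theorem abs_le_posMax (e : E → ℝ) (i : I → ℝ) (k : E) : |e k| ≤ posMax e i :=
  (posMax_le_iff.1 le_rfl).2.1 k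

theorem le_posMax (e : E → ℝ) (i : I → ℝ) (j : I) : i j ≤ posMax e i :=
  (posMax_le_iff.1 le_rfl).2.2 j

theorem posMax_add_le (e e' : E → ℝ) (i i' : I → ℝ) :
    posMax (e + e') (i + i') ≤ posMax e i + posMax e' i' :=
  posMax_le_iff.2 ⟨add_nonneg (posMax_nonneg _ _) (posMax_nonneg _ _),
    fun k => (abs_add_le _ _).trans (add_le_add (abs_le_posMax _ _ k) (abs_le_posMax _ _ k)),
    fun j => add_le_add (le_posMax _ _ j) (le_posMax _ _ j)⟩

theorem posMax_smul_le {c : ℝ} (hc : 0 ≤ c) (e : E → ℝ) (i : I → ℝ) :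
    posMax (c • e) (c • i) ≤ c * posMax e i :=
  posMax_le_iff.2 ⟨mul_nonneg hc (posMax_nonneg _ _),
    fun k => by
      simpa [abs_mul, abs_of_nonneg hc] using mul_le_mul_of_nonneg_left (abs_le_posMax e i k) hc,
    fun j => by simpa using mul_le_mul_of_nonneg_left (le_posMax e i j) hc⟩

/-- The inequality for `c` and the inequality for `c⁻¹` together force equality. -/
theorem posMax_smul {c : ℝ} (hc : 0 < c) (e : E → ℝ) (i : I → ℝ) :
    posMax (c • e) (c • i) = c * posMax e i := by
  refine (posMax_smul_le hc.le e i).antisymm ?_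
  have h := posMax_smul_le (inv_nonneg.2 hc.le) (c • e) (c • i)
  rw [inv_smul_smul₀ hc.ne', inv_smul_smul₀ hc.ne'] at h
  rwa [inv_mul_eq_div, le_div_iff₀ hc, mul_comm] at h

theorem posMax_le_norm (e : E → ℝ) (i : I → ℝ) : posMax e i ≤ ‖(e, i)‖ :=
  posMax_le_iff.2 ⟨norm_nonneg _,
    fun k => (norm_le_pi_norm e k).trans (norm_fst_le (e, i)),
    fun j => (le_abs_self _).trans ((norm_le_pi_norm i j).trans (norm_snd_le (e, i)))⟩

end MaxPos

/-! ### Hahn-Banach arguments: subgradients and multipliers. -/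

section Separation

variable {H : Type*} [NormedAddCommGroup H] [InnerProductSpace ℝ H] [CompleteSpace H]

/-- A convex cone in `H × ℝ` lying above the graph of `-r‖·‖` lies above the graph of a linear
functional of norm at most `r`. -/
theorem exists_inner_le_of_cone {C : Set (H × ℝ)} (hne : C.Nonempty)
    (hadd : ∀ x ∈ C, ∀ y ∈ C, x + y ∈ C) (hsmul : ∀ c : ℝ, 0 < c → ∀ x ∈ C, c • x ∈ C)
    {r : ℝ} (hr : 0 ≤ r) (hC : ∀ x ∈ C, -(r * ‖x.1‖) ≤ x.2) :
    ∃ p : H, ‖p‖ ≤ r ∧ ∀ x ∈ C, inner ℝ p x.1 ≤ x.2 := by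
  -- The open strict hypograph of `-r‖·‖`; it is a convex cone disjoint from `C`.
  set s : Set (H × ℝ) := {x | x.2 + r * ‖x.1‖ < 0} with hs
  have hsopen : IsOpen s := isOpen_lt (by fun_prop) continuous_const
  have hsconv : Convex ℝ s := by
    intro x hx y hy a b ha hb hab
    simp only [hs, mem_ofPred_eq, Prod.fst_add, Prod.snd_add, Prod.smul_fst, Prod.smul_snd,
      smul_eq_mul] at *
    have h1 : ‖a • x.1 + b • y.1‖ ≤ a * ‖x.1‖ + b * ‖y.1‖ := by
      refine (norm_add_le _ _).trans_eq ?_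
      rw [norm_smul, norm_smul, Real.norm_of_nonneg ha, Real.norm_of_nonneg hb]
    have h2 := mul_le_mul_of_nonneg_left h1 hr
    rcases ha.eq_or_lt with rfl | ha
    · obtain rfl : b = 1 := by linarith
      simp only [zero_smul, one_smul, zero_add, zero_mul, one_mul] at *
      linarith
    · nlinarith [mul_neg_of_pos_of_neg ha hx, mul_nonpos_of_nonneg_of_nonpos hb hy.le]
  have hCconv : Convex ℝ C := by
    intro x hx y hy a b ha hb hab
    rcases ha.eq_or_lt with rfl | ha
    · obtain rfl : b = 1 := by linarith
      simpa using hy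
    rcases hb.eq_or_lt with rfl | hb
    · obtain rfl : a = 1 := by linarith
      simpa using hx
    exact hadd _ (hsmul a ha x hx) _ (hsmul b hb y hy)
  have hdisj : Disjoint s C := Set.disjoint_left.2 fun x hx hxC => by
    have := hC x hxC
    simp only [hs, mem_ofPred_eq] at hx
    linarith
  obtain ⟨g, u, hg1, hg2⟩ := geometric_hahn_banach_open hsconv hsopen hCconv hdisj
  -- A positive separating constant is impossible: scaling a point of `C` brings its `g`-value down
  -- to `u / 2`.
  have hu : u ≤ 0 := by
    obtain ⟨b, hb⟩ := hne
    by_contra! hu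
    have hb' := hg2 b hb
    have hb0 : 0 < g b := hu.trans_le hb'
    have := hg2 _ (hsmul (u / (2 * g b)) (by positivity) b hb)
    rw [map_smul, smul_eq_mul, div_mul_eq_mul_div, mul_div_mul_right _ _ hb0.ne'] at this
    linarith
  -- A negative value could be scaled to `u - 1`, below the separating constant.
  have hgC : ∀ b ∈ C, 0 ≤ g b := by
    intro b hb
    by_contra! hlt
    have := hg2 _ (hsmul ((u - 1) / g b) (div_pos_of_neg_of_neg (by linarith) hlt) b hb)
    rw [map_smul, smul_eq_mul, div_mul_cancel₀ _ hlt.ne] at this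
    linarith
  have hgs : ∀ x ∈ s, g x < 0 := fun x hx => (hg1 x hx).trans_le hu
  set β := g (0, 1) with hβ
  have hβpos : 0 < β := by
    have := hgs (0, -1) (by simp [hs])
    have h2 : ((0 : H), (-1 : ℝ)) = -(0, 1) := by simp
    rw [h2, map_neg] at this
    linarith
  have hdec : ∀ x : H, ∀ y : ℝ, g (x, y) = g (x, 0) + y * β := by
    intro x y
    have : (x, y) = (x, (0 : ℝ)) + y • ((0 : H), (1 : ℝ)) := by simp
    rw [this, map_add, map_smul, smul_eq_mul]
  have hle : ∀ x : H, g (x, 0) ≤ r * ‖x‖ * β := by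
    intro x
    refine le_of_forall_pos_lt_add fun η hη => ?_
    have := hgs (x, -(r * ‖x‖) - η / β) (by
      simp only [hs, mem_ofPred_eq]
      have : 0 < η / β := by positivity
      linarith)
    rw [hdec, sub_mul, div_mul_cancel₀ _ hβpos.ne'] at this
    linarith
  -- As `β > 0`, the hyperplane `g = 0` is not vertical; it is the graph of this functional.
  set q : StrongDual ℝ H := (-β⁻¹) • g.comp (ContinuousLinearMap.inl ℝ H ℝ) with hq
  have hqx : ∀ x, q x = -(β⁻¹ * g (x, 0)) := fun x => by simp [hq]
  refine ⟨(InnerProductSpace.toDual ℝ H).symm q, ?_, fun x hx => ?_⟩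
  · rw [LinearIsometryEquiv.norm_map]
    refine ContinuousLinearMap.opNorm_le_bound _ hr fun x => ?_
    have key : ∀ x, β⁻¹ * g (x, 0) ≤ r * ‖x‖ := fun x => by
      rw [inv_mul_le_iff₀ hβpos]
      linarith [hle x]
    rw [hqx, Real.norm_eq_abs, abs_neg, abs_le]
    refine ⟨?_, key x⟩
    have h1 := key (-x)
    have h2 : ((-x : H), (0 : ℝ)) = -(x, 0) := by simp
    rw [h2, map_neg, norm_neg] at h1
    linarith
  · rw [InnerProductSpace.toDual_symm_apply, hqx]
    have := hgC x hx
    rw [← Prod.mk.eta (p := x), hdec] at this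
    rw [neg_le, ← sub_nonneg]
    have h3 : β⁻¹ * g (x.1, 0) - -x.2 = β⁻¹ * (g (x.1, 0) + x.2 * β) := by
      field_simp
      ring
    rw [h3]
    positivity

variable {D Y : Type*} [AddCommGroup D] [Module ℝ D] [AddCommGroup Y] [Module ℝ Y]

/-- Difference quotients of a convex function at a fixed base point do not increase as the step
shrinks: the point at step `ε'` is the convex combination of the ends with weights `1 - ε'/ε` and
`ε'/ε`. -/
theorem ConvexOn.slope_le_of_le {N : Y → ℝ} (hN : ConvexOn ℝ univ N) (v x : Y) {ε ε' : ℝ}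
    (hε' : 0 < ε') (hle : ε' ≤ ε) {s : ℝ} (hs : N (v + ε • x) - N v ≤ ε * s) :
    N (v + ε' • x) - N v ≤ ε' * s := by
  have hε : 0 < ε := hε'.trans_le hle
  have h := hN.2 (mem_univ v) (mem_univ (v + ε • x))
    (sub_nonneg.2 ((div_le_one hε).2 hle)) (by positivity) (sub_add_cancel 1 (ε' / ε))
  have h1 : (1 - ε' / ε) • v + (ε' / ε) • (v + ε • x) = v + ε' • x := by
    rw [smul_add, smul_smul, div_mul_cancel₀ _ hε.ne', ← add_assoc, ← add_smul]
    simp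
  rw [h1] at h
  simp only [smul_eq_mul] at h
  have h2 := mul_le_mul_of_nonneg_left hs (by positivity : 0 ≤ ε' / ε)
  have h3 : ε' / ε * (ε * s) = ε' * s := by field_simp
  nlinarith

/-- Subdifferentiation of a convex function along a convex cone of directions: a lower bound
`-r‖·‖` of the directional derivatives provides a subgradient of norm at most `r`. -/
theorem exists_subgradient_of_cone {N : Y → ℝ} (hN : ConvexOn ℝ univ N) (v : Y)
    (K : Set D) (h0 : (0 : D) ∈ K) (hadd : ∀ x ∈ K, ∀ y ∈ K, x + y ∈ K)
    (hsmul : ∀ c : ℝ, 0 < c → ∀ x ∈ K, c • x ∈ K) (ι : D →ₗ[ℝ] H) (G : D →ₗ[ℝ] Y)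
    {r : ℝ} (hr : 0 ≤ r)
    (hK : ∀ h ∈ K, ∀ η > 0, ∀ᶠ ε : ℝ in 𝓝[>] 0,
      -(ε * (r * ‖ι h‖ + η)) ≤ N (v + ε • G h) - N v) :
    ∃ p : H, ‖p‖ ≤ r ∧ ∀ h ∈ K, ∀ ε : ℝ, 0 < ε →
      ε * inner ℝ p (ι h) ≤ N (v + ε • G h) - N v := by
  -- Pairs of an image `ι h` and an upper bound for some difference quotient along `h`. Using images
  -- allows `ι` to identify different directions.
  let C : Set (H × ℝ) :=
    {x | ∃ h ∈ K, ι h = x.1 ∧ ∃ ε : ℝ, 0 < ε ∧ N (v + ε • G h) - N v ≤ ε * x.2}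
  obtain ⟨p, hp, hpC⟩ := exists_inner_le_of_cone (C := C) ⟨0, 0, h0, by simp, 1, one_pos, by simp⟩
    (by
      rintro ⟨x, s⟩ ⟨h, hh, rfl, ε, hε, hs⟩ ⟨y, s'⟩ ⟨h', hh', rfl, ε', hε', hs'⟩
      -- By monotonicity of slopes both bounds hold at the common step `min ε ε'`; the midpoint of
      -- the two displaced points moves along `h + h'` by half of it.
      refine ⟨h + h', hadd _ hh _ hh', by simp, min ε ε' / 2, by positivity, ?_⟩
      have hm : 0 < min ε ε' := lt_min hε hε'
      have e1 := hN.slope_le_of_le v (G h) hm (min_le_left _ _) hs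
      have e2 := hN.slope_le_of_le v (G h') hm (min_le_right _ _) hs'
      have e3 := hN.2 (mem_univ (v + min ε ε' • G h)) (mem_univ (v + min ε ε' • G h'))
        one_half_pos.le one_half_pos.le (add_halves 1)
      have e4 : (1 / 2 : ℝ) • (v + min ε ε' • G h) + (1 / 2 : ℝ) • (v + min ε ε' • G h')
          = v + (min ε ε' / 2) • G (h + h') := by
        rw [map_add]
        module
      rw [e4] at e3
      simp only [smul_eq_mul, Prod.mk_add_mk] at *
      nlinarith)
    (by
      rintro c hc ⟨x, s⟩ ⟨h, hh, rfl, ε, hε, hs⟩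
      refine ⟨c • h, hsmul c hc h hh, by simp, ε / c, by positivity, ?_⟩
      rw [map_smul, smul_smul, div_mul_cancel₀ _ hc.ne']
      simp only [Prod.smul_mk, smul_eq_mul]
      rwa [← mul_assoc, div_mul_cancel₀ _ hc.ne'])
    hr
    (by
      rintro ⟨x, s⟩ ⟨h, hh, rfl, ε, hε, hs⟩
      refine le_of_forall_pos_le_add fun η hη => ?_
      have hev : ∀ᶠ ε' : ℝ in 𝓝[>] 0, ε' ∈ Ioc 0 ε := Ioc_mem_nhdsGT hε
      obtain ⟨ε', h1, h2⟩ := ((hK h hh η hη).and hev).exists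
      have h3 := hN.slope_le_of_le v (G h) h2.1 h2.2 hs
      have h4 : ε' * (-(r * ‖ι h‖ + η)) ≤ ε' * s := by linarith
      have := le_of_mul_le_mul_left h4 h2.1
      simp only at *
      linarith)
  refine ⟨p, hp, fun h hh ε hε => ?_⟩
  have := hpC (ι h, (N (v + ε • G h) - N v) / ε)
    ⟨h, hh, rfl, ε, hε, by rw [mul_div_cancel₀ _ hε.ne']⟩
  rwa [le_div_iff₀ hε, mul_comm] at this

/-- Lagrange multipliers for a nonsmooth penalty that is a sum of a Hilbert norm and of a maximum
of finitely many linear functionals. -/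
theorem exists_multipliers {E I : Type*} [Fintype E] [Fintype I] (A : D →ₗ[ℝ] H) (a : D →ₗ[ℝ] ℝ)
    (e : D →ₗ[ℝ] E → ℝ) (c : D →ₗ[ℝ] I → ℝ) (act : Set I) {lam : ℝ} (hlam : 0 ≤ lam)
    (hopt : ∀ h, 0 ≤ a h + lam * (‖A h‖ + posMax (e h) (act.indicator (c h)))) :
    ∃ (σ : H) (ν : E → ℝ) (μ : I → ℝ), ‖σ‖ ≤ lam ∧ (∀ k, |ν k| ≤ lam) ∧
      (∀ j, 0 ≤ μ j ∧ μ j ≤ lam) ∧ (∀ j ∉ act, μ j = 0) ∧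
      ∀ h, a h + inner ℝ σ (A h) + ∑ k, ν k * e h k + ∑ j, μ j * c h j = 0 := by
  classical
  -- The last coordinate carries `a`, so that `-a` is a well-defined functional on the range even
  -- where `A`, `e` and `c` do not determine it.
  let Gm : D →ₗ[ℝ] (H × (E → ℝ) × (I → ℝ) × ℝ) := A.prod (e.prod (c.prod a))
  let fl : (H × (E → ℝ) × (I → ℝ) × ℝ) →ₗ[ℝ] ℝ := -((LinearMap.snd ℝ (I → ℝ) ℝ).comp
    ((LinearMap.snd ℝ (E → ℝ) ((I → ℝ) × ℝ)).comp (LinearMap.snd ℝ H ((E → ℝ) × (I → ℝ) × ℝ))))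
  let N : (H × (E → ℝ) × (I → ℝ) × ℝ) → ℝ := fun x =>
    lam * (‖x.1‖ + posMax x.2.1 (act.indicator x.2.2.1))
  obtain ⟨g, hg1, hg2⟩ := exists_extension_of_le_sublinear
    ⟨LinearMap.range Gm, fl.domRestrict _⟩ N
    (by
      intro t ht x
      simp only [N, Prod.smul_fst, Prod.smul_snd, norm_smul, Real.norm_of_nonneg ht.le]
      rw [show act.indicator (t • x.2.2.1) = t • act.indicator x.2.2.1 from
        Set.indicator_const_smul act t x.2.2.1, posMax_smul ht]
      ring)
    (by
      intro x y
      simp only [N, Prod.fst_add, Prod.snd_add, Set.indicator_add']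
      rw [← mul_add]
      refine mul_le_mul_of_nonneg_left ?_ hlam
      linarith [norm_add_le x.1 y.1, posMax_add_le x.2.1 y.2.1
        (act.indicator x.2.2.1) (act.indicator y.2.2.1)])
    (by
      rintro ⟨x, h, rfl⟩
      have := hopt h
      simp only [N, Gm, fl, LinearPMap.mk_apply, LinearMap.domRestrict_apply, LinearMap.prod_apply,
        Function.prod_apply, LinearMap.neg_apply, LinearMap.comp_apply, LinearMap.snd_apply] at *
      linarith)
  have hgG : ∀ h, g (Gm h) = -a h := fun h => hg1 ⟨Gm h, h, rfl⟩
  have hz : act.indicator (0 : I → ℝ) = 0 := Set.indicator_zero' _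
  have hp0 : posMax (0 : E → ℝ) (0 : I → ℝ) = 0 :=
    le_antisymm (posMax_le_iff.2 ⟨le_rfl, by simp, by simp⟩) (posMax_nonneg _ _)
  let gH : H →ₗ[ℝ] ℝ := g.comp (LinearMap.inl ℝ H _)
  have hgHle : ∀ y, gH y ≤ lam * ‖y‖ := fun y => by
    refine (hg2 (y, 0, 0, 0)).trans_eq ?_
    simp [N, hz, hp0]
  have hgH : ∀ y, ‖gH y‖ ≤ lam * ‖y‖ := fun y => by
    rw [Real.norm_eq_abs, abs_le]
    refine ⟨?_, hgHle y⟩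
    have := hgHle (-y)
    rw [map_neg, norm_neg] at this
    linarith
  let q : StrongDual ℝ H := gH.mkContinuous lam hgH
  -- The dominating function ignores the last coordinate, so the extension cannot depend on it.
  have hg4 : g (0, 0, 0, 1) = 0 := by
    have h1 := hg2 (0, 0, 0, 1)
    have h2 := hg2 (-(0, 0, 0, 1))
    rw [map_neg] at h2
    simp [N, hz, hp0] at h1 h2
    linarith
  refine ⟨(InnerProductSpace.toDual ℝ H).symm q, fun k => g (0, Pi.single k 1, 0, 0),
    fun j => g (0, 0, Pi.single j 1, 0), ?_, ?_, ?_, ?_, ?_⟩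
  · rw [LinearIsometryEquiv.norm_map]
    exact LinearMap.mkContinuous_norm_le _ hlam _
  · intro k
    have hs : ∀ s : ℝ, |s| = 1 → g (0, s • Pi.single k 1, 0, 0) ≤ lam := by
      intro s hs
      refine (hg2 _).trans ?_
      simp only [N, norm_zero, zero_add, hz]
      refine mul_le_of_le_one_right hlam (posMax_le_iff.2 ⟨zero_le_one, fun k' => ?_, by simp⟩)
      simp only [Pi.smul_apply, smul_eq_mul, abs_mul, hs, one_mul]
      by_cases hk : k' = k
      · subst hk; simp
      · simp [hk]
    have e1 := hs 1 (by simp)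
    have e2 := hs (-1) (by simp)
    have e3 : ((0 : H), (-1 : ℝ) • (Pi.single k 1 : E → ℝ), (0 : I → ℝ), (0 : ℝ))
      = -(0, Pi.single k 1, 0, 0) := by simp
    rw [e3, map_neg] at e2
    rw [one_smul] at e1
    exact abs_le.2 ⟨by linarith, e1⟩
  · intro j
    constructor
    · have h2 := hg2 (-(0, 0, Pi.single j 1, 0))
      rw [map_neg] at h2
      -- Decreasing an inequality constraint is never penalized; this one-sidedness gives `μ j` its
      -- sign.
      have h3 : N (-(0, 0, Pi.single j 1, 0)) ≤ 0 := by
        simp only [N, Prod.neg_mk, neg_zero, norm_zero, zero_add]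
        refine mul_nonpos_of_nonneg_of_nonpos hlam
          (posMax_le_iff.2 ⟨le_rfl, by simp, fun j' => ?_⟩)
        refine Set.indicator_apply_le' (fun _ => ?_) (fun _ => le_rfl)
        simp only [Pi.neg_apply, Left.neg_nonpos_iff]
        exact (Pi.single_nonneg.2 zero_le_one : (0 : I → ℝ) ≤ Pi.single j 1) j'
      linarith
    · refine (hg2 _).trans ?_
      simp only [N, norm_zero, zero_add]
      refine mul_le_of_le_one_right hlam
          (posMax_le_iff.2 ⟨zero_le_one, by simp, fun j' => ?_⟩)
      refine Set.indicator_apply_le' (fun _ => ?_) (fun _ => zero_le_one)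
      by_cases hj : j' = j
      · subst hj; simp
      · simp [hj]
  · intro j hj
    -- Inactive coordinates are invisible to the dominating function in both directions, which is
    -- complementary slackness.
    have hind : ∀ s : ℝ, act.indicator (s • Pi.single j 1 : I → ℝ) = 0 := by
      intro s
      ext j'
      by_cases hj' : j' = j
      · subst hj'; simp [hj]
      · simp [Set.indicator, hj']
    have hs : ∀ s : ℝ, g (0, 0, s • Pi.single j 1, 0) ≤ 0 := fun s => by
      refine (hg2 _).trans_eq ?_
      simp only [N, norm_zero, hind, hp0, add_zero, mul_zero]
    have e1 := hs 1
    have e2 := hs (-1)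
    have e3 : ((0 : H), (0 : E → ℝ), (-1 : ℝ) • (Pi.single j 1 : I → ℝ), (0 : ℝ))
      = -(0, 0, Pi.single j 1, 0) := by simp
    rw [e3, map_neg] at e2
    rw [one_smul] at e1
    linarith
  · intro h
    have hsplit : Gm h = (A h, 0, 0, 0)
        + ∑ k, e h k • ((0, Pi.single k 1, 0, 0) : (H × (E → ℝ) × (I → ℝ) × ℝ))
        + ∑ j, c h j • ((0, 0, Pi.single j 1, 0) : (H × (E → ℝ) × (I → ℝ) × ℝ))
        + a h • ((0, 0, 0, 1) : (H × (E → ℝ) × (I → ℝ) × ℝ)) := by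
      refine Prod.ext ?_ (Prod.ext ?_ (Prod.ext ?_ ?_))
      · simp [Gm, Prod.fst_sum]
      · simp only [Gm, Prod.snd_sum, Prod.fst_sum, LinearMap.prod_apply, Function.prod_apply,
          Prod.fst_add, Prod.snd_add, Prod.smul_mk, smul_zero, Finset.sum_const_zero, zero_add,
          add_zero]
        ext k; simp [Finset.sum_apply, Pi.single_apply]
      · simp only [Gm, Prod.snd_sum, Prod.fst_sum, LinearMap.prod_apply, Function.prod_apply,
          Prod.fst_add, Prod.snd_add, Prod.smul_mk, smul_zero, Finset.sum_const_zero, zero_add,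
          add_zero]
        ext k; simp [Finset.sum_apply, Pi.single_apply]
      · simp [Gm, Prod.snd_sum]
    have h1 := hgG h
    rw [hsplit, map_add, map_add, map_add, map_sum, map_sum, map_smul, hg4] at h1
    simp only [map_smul, smul_eq_mul, mul_zero, add_zero] at h1
    rw [InnerProductSpace.toDual_symm_apply]
    have h2 : q (A h) = g (A h, 0, 0, 0) := rfl
    rw [h2]
    simp only [mul_comm (g _)]
    linarith

end Separation

/-! ### Bounded measurable and piecewise continuous functions. -/

section BddMeas

variable {W W' : Type*} [NormedAddCommGroup W] [NormedAddCommGroup W'] {a b : ℝ}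

/-- Bounded measurable functions on `[a, b]`. -/
def BddMeas (g : ℝ → W) (a b : ℝ) : Prop :=
  AEStronglyMeasurable g (volume.restrict (Icc a b)) ∧ ∃ C, ∀ t ∈ Icc a b, ‖g t‖ ≤ C

theorem BddMeas.prodMk {g : ℝ → W} {g' : ℝ → W'} (h : BddMeas g a b) (h' : BddMeas g' a b) :
    BddMeas (fun t => (g t, g' t)) a b := by
  obtain ⟨hm, C, hC⟩ := h
  obtain ⟨hm', C', hC'⟩ := h'
  exact ⟨hm.prodMk hm', max C C', fun t ht =>
    max_le_max (hC t ht) (hC' t ht)⟩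

/-- The values stay in a closed ball, compact since the space is proper, on which `F` is bounded. -/
theorem BddMeas.comp_continuous [ProperSpace W] {g : ℝ → W} (h : BddMeas g a b) {F : W → W'}
    (hF : Continuous F) : BddMeas (fun t => F (g t)) a b := by
  obtain ⟨hm, C, hC⟩ := h
  refine ⟨hF.comp_aestronglyMeasurable hm, ?_⟩
  obtain ⟨C', hC'⟩ := (isCompact_closedBall (0 : W) C).exists_bound_of_continuousOn hF.continuousOn
  exact ⟨C', fun t ht => hC' _ (by simpa using hC t ht)⟩

theorem ContinuousOn.bddMeas {g : ℝ → W} (h : ContinuousOn g (Icc a b)) :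
    BddMeas g a b :=
  ⟨h.aestronglyMeasurable measurableSet_Icc, isCompact_Icc.exists_bound_of_continuousOn h⟩

theorem BddMeas.memLp {g : ℝ → W} (h : BddMeas g a b) (p : ENNReal) :
    MemLp g p (volume.restrict (Icc a b)) := by
  obtain ⟨hm, C, hC⟩ := h
  exact MemLp.of_bound hm C ((ae_restrict_iff' measurableSet_Icc).2 (ae_of_all _ hC))

theorem BddMeas.intervalIntegrable {g : ℝ → W} (h : BddMeas g a b) {s t : ℝ} (hs : s ∈ Icc a b)
    (ht : t ∈ Icc a b) : IntervalIntegrable g volume s t := by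
  have h1 : IntegrableOn g (Icc a b) := memLp_one_iff_integrable.1 (h.memLp 1)
  exact ((intervalIntegrable_iff.2 (h1.mono_set (by
    rw [uIoc_of_le (hs.1.trans hs.2)]; exact Ioc_subset_Icc_self))) :
      IntervalIntegrable g volume a b).mono_set (by
        rw [uIcc_of_le (hs.1.trans hs.2)]; exact uIcc_subset_Icc hs ht)

theorem BddMeas.continuousOn_primitive [NormedSpace ℝ W] {g : ℝ → W} (hab : a ≤ b)
    (h : BddMeas g a b) : ContinuousOn (fun t => ∫ τ in a..t, g τ) (Icc a b) := by
  have h1 : IntegrableOn g (uIcc a b) := by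
    rw [uIcc_of_le hab]
    exact memLp_one_iff_integrable.1 (h.memLp 1)
  have := intervalIntegral.continuousOn_primitive_interval h1
  rwa [uIcc_of_le hab] at this

end BddMeas

section PiecewiseContinuous

variable {k : ℕ} {a b : ℝ} {g g' : ℝ → Vec k}

theorem PiecewiseContinuous.add (h : PiecewiseContinuous g a b)
    (h' : PiecewiseContinuous g' a b) : PiecewiseContinuous (g + g') a b := by
  classical
  obtain ⟨⟨S, hS⟩, h1, h2⟩ := h
  obtain ⟨⟨S', hS'⟩, h1', h2'⟩ := h'
  refine ⟨⟨S ∪ S', fun t ht hts => ?_⟩, fun t ht => ?_, fun t ht => ?_⟩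
  · rw [Finset.notMem_union] at hts
    exact (hS t ht hts.1).add (hS' t ht hts.2)
  · obtain ⟨l, hl⟩ := h1 t ht
    obtain ⟨l', hl'⟩ := h1' t ht
    exact ⟨l + l', hl.add hl'⟩
  · obtain ⟨l, hl⟩ := h2 t ht
    obtain ⟨l', hl'⟩ := h2' t ht
    exact ⟨l + l', hl.add hl'⟩

theorem PiecewiseContinuous.const_smul (h : PiecewiseContinuous g a b) (c : ℝ) :
    PiecewiseContinuous (c • g) a b := by
  obtain ⟨⟨S, hS⟩, h1, h2⟩ := h
  refine ⟨⟨S, fun t ht hts => (hS t ht hts).const_smul c⟩, fun t ht => ?_, fun t ht => ?_⟩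
  · obtain ⟨l, hl⟩ := h1 t ht
    exact ⟨c • l, hl.const_smul c⟩
  · obtain ⟨l, hl⟩ := h2 t ht
    exact ⟨c • l, hl.const_smul c⟩

theorem Continuous.piecewiseContinuous (h : Continuous g) (a b : ℝ) :
    PiecewiseContinuous g a b :=
  ⟨⟨∅, fun _ _ _ => h.continuousWithinAt⟩, fun t _ => ⟨g t, h.continuousWithinAt⟩,
    fun t _ => ⟨g t, h.continuousWithinAt⟩⟩

/-- Removing the finite exceptional set does not affect almost everywhere measurability. One-sided
limits and the value at the point give local bounds, which compactness makes global. -/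
theorem PiecewiseContinuous.bddMeas (h : PiecewiseContinuous g a b) : BddMeas g a b := by
  obtain ⟨⟨S, hS⟩, h1, h2⟩ := h
  constructor
  · have hc : ContinuousOn g (Icc a b \ S) := fun t ht => (hS t ht.1 ht.2).mono sdiff_subset
    have hm := hc.aestronglyMeasurable (μ := volume)
      (measurableSet_Icc.diff S.finite_toSet.measurableSet)
    have hae : (Icc a b \ S : Set ℝ) =ᵐ[volume] Icc a b :=
      sdiff_null_ae_eq_self (S.finite_toSet.measure_zero _)
    rwa [Measure.restrict_congr_set hae] at hm
  · have hloc : ∀ t ∈ Icc a b, ∃ U ∈ 𝓝[Icc a b] t, ∃ C, ∀ τ ∈ U, ‖g τ‖ ≤ C := by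
      intro t ht
      have hside : ∀ s : Set ℝ, (∃ l, Tendsto g (𝓝[s] t) (𝓝 l)) →
          ∃ C, ∀ᶠ τ in 𝓝[s] t, ‖g τ‖ ≤ C := by
        rintro s ⟨l, hl⟩
        exact ⟨‖l‖ + 1, (hl.norm.eventually (gt_mem_nhds (lt_add_one ‖l‖))).mono
          fun _ h => h.le⟩
      have hl : ∃ C, ∀ᶠ τ in 𝓝[Icc a b ∩ Iio t] t, ‖g τ‖ ≤ C := by
        rcases ht.1.eq_or_lt with rfl | hat
        · refine ⟨0, ?_⟩
          have : Icc a b ∩ Iio a = ∅ := by ext x; simp; grind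
          simp [this]
        · obtain ⟨C, hC⟩ := hside _ (h1 t ⟨hat, ht.2⟩)
          exact ⟨C, hC.filter_mono (nhdsWithin_mono _ inter_subset_right)⟩
      have hr : ∃ C, ∀ᶠ τ in 𝓝[Icc a b ∩ Ioi t] t, ‖g τ‖ ≤ C := by
        rcases ht.2.eq_or_lt with rfl | htb
        · refine ⟨0, ?_⟩
          have : Icc a t ∩ Ioi t = ∅ := by ext x; simp
          simp [this]
        · obtain ⟨C, hC⟩ := hside _ (h2 t ⟨ht.1, htb⟩)
          exact ⟨C, hC.filter_mono (nhdsWithin_mono _ inter_subset_right)⟩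
      obtain ⟨C₁, hC₁⟩ := hl
      obtain ⟨C₂, hC₂⟩ := hr
      have hsplit : Icc a b ⊆ (Icc a b ∩ Iio t) ∪ ((Icc a b ∩ Ioi t) ∪ {t}) := by
        intro x hx
        rcases lt_trichotomy x t with h | h | h <;> simp_all
      have hev : ∀ᶠ τ in 𝓝[Icc a b] t, ‖g τ‖ ≤ max (max C₁ C₂) ‖g t‖ := by
        refine Filter.Eventually.filter_mono (nhdsWithin_mono _ hsplit) ?_
        rw [nhdsWithin_union, nhdsWithin_union, eventually_sup, eventually_sup, nhdsWithin_singleton,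
          eventually_pure]
        exact ⟨hC₁.mono fun _ h => h.trans (by simp), hC₂.mono fun _ h => h.trans (by simp),
          by simp⟩
      exact ⟨_, hev, _, fun _ h => h⟩
    refine isCompact_Icc.induction_on (p := fun s => ∃ C, ∀ t ∈ s, ‖g t‖ ≤ C) ⟨0, by simp⟩
      (fun s t hst ⟨C, hC⟩ => ⟨C, fun x hx => hC x (hst hx)⟩)
      (fun s t ⟨C, hC⟩ ⟨C', hC'⟩ => ⟨max C C', fun x hx => hx.elim
        (fun h => (hC x h).trans (le_max_left _ _)) fun h => (hC' x h).trans (le_max_right _ _)⟩)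
      hloc

end PiecewiseContinuous

/-! ### Passage to classes in L². -/

section ToL2

variable {W : Type*} [NormedAddCommGroup W] {a b : ℝ}

open Classical in
/-- The class in `L²([a, b])` of a square integrable function (zero for other functions). -/
def toL2 (a b : ℝ) (g : ℝ → W) : Lp W 2 (volume.restrict (Icc a b)) :=
  if h : MemLp g 2 (volume.restrict (Icc a b)) then h.toLp g else 0

theorem toL2_of_memLp {g : ℝ → W} (h : MemLp g 2 (volume.restrict (Icc a b))) :
    toL2 a b g = h.toLp g := dif_pos h

theorem toL2_add {g g' : ℝ → W} (h : MemLp g 2 (volume.restrict (Icc a b)))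
    (h' : MemLp g' 2 (volume.restrict (Icc a b))) :
    toL2 a b (g + g') = toL2 a b g + toL2 a b g' := by
  rw [toL2_of_memLp h, toL2_of_memLp h', toL2_of_memLp (h.add h')]
  rfl

theorem toL2_sub {g g' : ℝ → W} (h : MemLp g 2 (volume.restrict (Icc a b)))
    (h' : MemLp g' 2 (volume.restrict (Icc a b))) :
    toL2 a b (g - g') = toL2 a b g - toL2 a b g' := by
  rw [toL2_of_memLp h, toL2_of_memLp h', toL2_of_memLp (h.sub h')]
  rfl

theorem toL2_congr {g g' : ℝ → W} (h : ∀ t ∈ Icc a b, g t = g' t) :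
    toL2 a b g = toL2 a b g' := by
  have hae : g =ᵐ[volume.restrict (Icc a b)] g' :=
    (ae_restrict_iff' measurableSet_Icc).2 (ae_of_all _ h)
  by_cases hg : MemLp g 2 (volume.restrict (Icc a b))
  · have hg' := (memLp_congr_ae hae).1 hg
    rw [toL2_of_memLp hg, toL2_of_memLp hg', MemLp.toLp_eq_toLp_iff]
    exact hae
  · have hg' := mt (memLp_congr_ae hae).2 hg
    rw [toL2, toL2, dif_neg hg, dif_neg hg']

theorem toL2_coeFn (p : Lp W 2 (volume.restrict (Icc a b))) : toL2 a b p = p := by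
  rw [toL2_of_memLp (Lp.memLp p), Lp.toLp_coeFn]

variable [InnerProductSpace ℝ W]

theorem toL2_smul {g : ℝ → W} (h : MemLp g 2 (volume.restrict (Icc a b))) (c : ℝ) :
    toL2 a b (c • g) = c • toL2 a b g := by
  rw [toL2_of_memLp h, toL2_of_memLp (h.const_smul c)]
  rfl

theorem inner_toL2 (hab : a ≤ b) {g g' : ℝ → W} (h : MemLp g 2 (volume.restrict (Icc a b)))
    (h' : MemLp g' 2 (volume.restrict (Icc a b))) :
    inner ℝ (toL2 a b g) (toL2 a b g') = ∫ t in a..b, inner ℝ (g t) (g' t) := by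
  rw [toL2_of_memLp h, toL2_of_memLp h', L2.inner_def, intervalIntegral.integral_of_le hab,
    restrict_Ioc_eq_restrict_Icc]
  refine integral_congr_ae ?_
  filter_upwards [h.coeFn_toLp, h'.coeFn_toLp] with t h1 h2
  rw [h1, h2]

theorem norm_toL2_sq (hab : a ≤ b) {g : ℝ → W} (h : MemLp g 2 (volume.restrict (Icc a b))) :
    ‖toL2 a b g‖ ^ 2 = ∫ t in a..b, ‖g t‖ ^ 2 := by
  rw [← real_inner_self_eq_norm_sq, inner_toL2 hab h h]
  simp_rw [real_inner_self_eq_norm_sq]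

theorem norm_toL2 (hab : a ≤ b) {g : ℝ → W} (h : MemLp g 2 (volume.restrict (Icc a b))) :
    ‖toL2 a b g‖ = Real.sqrt (∫ t in a..b, ‖g t‖ ^ 2) := by
  rw [← norm_toL2_sq hab h, Real.sqrt_sq (norm_nonneg _)]

theorem norm_toL2_le (hab : a ≤ b) {g : ℝ → W} (h : MemLp g 2 (volume.restrict (Icc a b)))
    {C : ℝ} (hC : ∀ t ∈ Icc a b, ‖g t‖ ≤ C) : ‖toL2 a b g‖ ≤ C * Real.sqrt (b - a) := by
  have hC0 : 0 ≤ C := (norm_nonneg _).trans (hC a (left_mem_Icc.2 hab))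
  rw [norm_toL2 hab h]
  refine Real.sqrt_le_iff.2 ⟨by positivity, ?_⟩
  rw [mul_pow, Real.sq_sqrt (sub_nonneg.2 hab)]
  have h1 : IntervalIntegrable (fun t => ‖g t‖ ^ 2) volume a b := by
    rw [intervalIntegrable_iff_integrableOn_Icc_of_le hab]
    exact h.integrable_norm_pow (by norm_num)
  have h2 := intervalIntegral.integral_mono_on hab h1 intervalIntegrable_const
    (fun t ht => pow_le_pow_left₀ (norm_nonneg _) (hC t ht) 2)
  simpa [mul_comm] using h2

/-- A curve of bounded functions that is differentiable uniformly on `[a, b]` is differentiable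
in `L²`. -/
theorem hasDerivWithinAt_toL2 (hab : a ≤ b) {R : ℝ → ℝ → W} {R' : ℝ → W}
    (hR : ∀ ε, BddMeas (R ε) a b) (hR' : BddMeas R' a b)
    (h : ∀ η > 0, ∀ᶠ ε : ℝ in 𝓝[>] 0, ∀ t ∈ Icc a b, ‖R ε t - R 0 t - ε • R' t‖ ≤ η * ε) :
    HasDerivWithinAt (fun ε => toL2 a b (R ε)) (toL2 a b R') (Ioi 0) 0 := by
  rw [hasDerivWithinAt_iff_isLittleO, Asymptotics.isLittleO_iff]
  intro c hc
  have hpos : 0 < Real.sqrt (b - a) + 1 := by positivity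
  -- A uniform bound costs a factor `√(b - a)` in L²; the added `1` keeps the divisor positive when
  -- `a = b`.
  filter_upwards [h (c / (Real.sqrt (b - a) + 1)) (by positivity), self_mem_nhdsWithin]
    with ε hε hε0
  have hε0 : 0 < ε := hε0
  have m1 := (hR ε).memLp 2
  have m0 := (hR 0).memLp 2
  have m' := hR'.memLp 2
  rw [sub_zero, ← toL2_sub m1 m0, ← toL2_smul m', ← toL2_sub (m1.sub m0) (m'.const_smul ε)]
  refine (norm_toL2_le hab ((m1.sub m0).sub (m'.const_smul ε)) hε).trans ?_
  rw [Real.norm_of_nonneg hε0.le, mul_right_comm]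
  refine mul_le_mul_of_nonneg_right ?_ hε0.le
  rw [div_mul_eq_mul_div, div_le_iff₀ hpos]
  nlinarith

end ToL2

/-! ### First-order expansion, uniform on compact sets. -/

section UniformTaylor

variable {X U F : Type*} [NormedAddCommGroup X] [NormedSpace ℝ X] [NormedAddCommGroup U]
  [NormedSpace ℝ U] [NormedAddCommGroup F] [NormedSpace ℝ F]

/-- Joint differentiability is not assumed of the dynamics; it comes from the joint continuity of
the partial derivatives. -/
theorem hasFDerivAt_of_continuous_partials {f : X → U → F}
    (hx : ∀ u, Differentiable ℝ fun y => f y u)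
    (hu : ∀ x, Differentiable ℝ fun v => f x v)
    (cx : Continuous fun p : X × U => fderiv ℝ (fun y => f y p.2) p.1)
    (cu : Continuous fun p : X × U => fderiv ℝ (fun v => f p.1 v) p.2) (x : X) (u : U) :
    HasFDerivAt (fun p : X × U => f p.1 p.2)
      ((fderiv ℝ (fun y => f y u) x).coprod (fderiv ℝ (fun v => f x v) u)) (x, u) :=
  (hasStrictFDerivAt_uncurry_coprod (f := f) (u := (x, u))
    (f₁ := fun x u => fderiv ℝ (fun y => f y u) x) (f₂ := fun x u => fderiv ℝ (fun v => f x v) u)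
    (Eventually.of_forall fun p => (hx p.2 p.1).hasFDerivAt)
    (Eventually.of_forall fun p => (hu p.1 p.2).hasFDerivAt)
    cx.continuousAt cu.continuousAt).hasFDerivAt

/-- First order expansion along segments, uniformly on compact sets of base points and
directions. -/
theorem eventually_forall_norm_taylor_le {Λ : Type*} [TopologicalSpace Λ] {f : X → U → Λ → F}
    (hx : ∀ u t, Differentiable ℝ fun y => f y u t) (hu : ∀ x t, Differentiable ℝ fun v => f x v t)
    (cx : Continuous fun p : X × U × Λ => fderiv ℝ (fun y => f y p.2.1 p.2.2) p.1)
    (cu : Continuous fun p : X × U × Λ => fderiv ℝ (fun v => f p.1 v p.2.2) p.2.1)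
    {K : Set (X × X × U × U × Λ)} (hK : IsCompact K) {η : ℝ} (hη : 0 < η) :
    ∀ᶠ ε : ℝ in 𝓝[>] 0, ∀ p ∈ K,
      ‖f (p.1 + ε • p.2.1) (p.2.2.1 + ε • p.2.2.2.1) p.2.2.2.2 - f p.1 p.2.2.1 p.2.2.2.2 -
        ε • (fderiv ℝ (fun y => f y p.2.2.1 p.2.2.2.2) p.1 p.2.1 +
          fderiv ℝ (fun v => f p.1 v p.2.2.2.2) p.2.2.1 p.2.2.2.1)‖ ≤ η * ε := by
  -- `Γ (s, p)` is the velocity at time `s` of `f` along the segment encoded by `p`.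
  let Γ : ℝ × (X × X × U × U × Λ) → F := fun q =>
    fderiv ℝ (fun y => f y (q.2.2.2.1 + q.1 • q.2.2.2.2.1) q.2.2.2.2.2) (q.2.1 + q.1 • q.2.2.1)
        q.2.2.1 +
      fderiv ℝ (fun v => f (q.2.1 + q.1 • q.2.2.1) v q.2.2.2.2.2) (q.2.2.2.1 + q.1 • q.2.2.2.2.1)
        q.2.2.2.2.1
  have hΓ : Continuous Γ := by
    have c : Continuous fun q : ℝ × (X × X × U × U × Λ) =>
        (q.2.1 + q.1 • q.2.2.1, q.2.2.2.1 + q.1 • q.2.2.2.2.1, q.2.2.2.2.2) := by fun_prop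
    exact ((cx.comp c).clm_apply (by fun_prop)).add ((cu.comp c).clm_apply (by fun_prop))
  have hev : ∀ᶠ s : ℝ in 𝓝 0, ∀ p ∈ K, ‖Γ (s, p) - Γ (0, p)‖ < η := by
    refine hK.eventually_forall_of_forall_eventually fun p _ => ?_
    have hc : Continuous fun z : ℝ × (X × X × U × U × Λ) => ‖Γ z - Γ (0, z.2)‖ := by fun_prop
    exact hc.continuousAt.eventually (gt_mem_nhds (by simpa using hη))
  obtain ⟨δ, hδ, hball⟩ := Metric.eventually_nhds_iff.1 hev
  filter_upwards [Ioo_mem_nhdsGT hδ] with ε hε p hp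
  obtain ⟨x, k, u, l, t⟩ := p
  have hder : ∀ s : ℝ, HasDerivAt (fun s : ℝ => f (x + s • k) (u + s • l) t)
      (Γ (s, (x, k, u, l, t))) s := by
    intro s
    have h1 := hasFDerivAt_of_continuous_partials (f := fun y v => f y v t) (fun v => hx v t)
      (fun y => hu y t)
      (cx.comp (by fun_prop : Continuous fun p : X × U => (p.1, p.2, t)))
      (cu.comp (by fun_prop : Continuous fun p : X × U => (p.1, p.2, t))) (x + s • k) (u + s • l)
    have h2 : HasDerivAt (fun s : ℝ => (x + s • k, u + s • l)) (k, l) s := by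
      refine HasDerivAt.prodMk ?_ ?_
      · simpa using ((hasDerivAt_id s).smul_const k).const_add x
      · simpa using ((hasDerivAt_id s).smul_const l).const_add u
    exact h1.comp_hasDerivAt s h2
  -- The mean value inequality applies to `f` minus its tangent line, whose derivative is below `η`
  -- on all of `[0, ε]`.
  have hmv := (convex_Icc 0 ε).norm_image_sub_le_of_norm_hasDerivWithin_le
    (f := fun s : ℝ => f (x + s • k) (u + s • l) t - s • Γ (0, (x, k, u, l, t)))
    (f' := fun s => Γ (s, (x, k, u, l, t)) - Γ (0, (x, k, u, l, t))) (C := η)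
    (fun s _ => by
      have := ((hder s).fun_sub ((hasDerivAt_id s).smul_const (Γ (0, (x, k, u, l, t)))))
      rw [one_smul] at this
      exact this.hasDerivWithinAt)
    (fun s hs => (hball (y := s) (by
      rw [dist_zero_right, Real.norm_of_nonneg hs.1]
      exact hs.2.trans_lt hε.2) _ hp).le)
    (left_mem_Icc.2 hε.1.le) (right_mem_Icc.2 hε.1.le)
  simp only [zero_smul, add_zero, sub_zero, Real.norm_of_nonneg hε.1.le, Γ] at hmv
  rwa [sub_right_comm] at hmv

end UniformTaylor

/-! ### The defect and its linearization. -/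

namespace MayerProblem

variable {n m : ℕ} {E I : Type*} (P : MayerProblem n m E I)

/-- The vector space of piecewise continuous pairs. -/
def pcPairs : Submodule ℝ (VelCtrl n m) where
  carrier := {w | PiecewiseContinuous w.1 P.t₀ P.T ∧ PiecewiseContinuous w.2 P.t₀ P.T}
  add_mem' h h' := ⟨h.1.add h'.1, h.2.add h'.2⟩
  zero_mem' := ⟨continuous_zero.piecewiseContinuous _ _, continuous_zero.piecewiseContinuous _ _⟩
  smul_mem' c _ h := ⟨h.1.const_smul c, h.2.const_smul c⟩

theorem domain_subset_pcPairs {w : VelCtrl n m} (hw : w ∈ P.domain) : w ∈ P.pcPairs :=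
  ⟨hw.1, hw.2.1⟩

/-- The defect in the state equation. -/
def defect (w : VelCtrl n m) (t : ℝ) : Vec n := w.1 t - P.f (P.traj w.1 t) (w.2 t) t

/-- The linearization of the defect at `w` in the direction `h`. -/
def linDefect (w h : VelCtrl n m) (t : ℝ) : Vec n :=
  h.1 t - (P.fx (P.traj w.1 t) (w.2 t) t (∫ τ in P.t₀..t, h.1 τ) +
    P.fu (P.traj w.1 t) (w.2 t) t (h.2 t))

variable {P} {w h h' : VelCtrl n m}

theorem linDefect_smul (c : ℝ) (t : ℝ) :
    P.linDefect w (c • h) t = c • P.linDefect w h t := by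
  simp only [linDefect, Prod.smul_fst, Prod.smul_snd, Pi.smul_apply]
  rw [intervalIntegral.integral_smul, map_smul, map_smul, ← smul_add, ← smul_sub]

namespace Regular

theorem left_mem (hP : P.Regular) : P.t₀ ∈ Icc P.t₀ P.T := left_mem_Icc.2 hP.t₀_lt_T.le

theorem right_mem (hP : P.Regular) : P.T ∈ Icc P.t₀ P.T := right_mem_Icc.2 hP.t₀_lt_T.le

theorem intervalIntegrable_fst (hP : P.Regular) (hw : w ∈ P.pcPairs) {t : ℝ} (ht : t ∈ Icc P.t₀ P.T) :
    IntervalIntegrable w.1 volume P.t₀ t :=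
  hw.1.bddMeas.intervalIntegrable hP.left_mem ht

theorem continuousOn_primitive (hP : P.Regular) (hw : w ∈ P.pcPairs) :
    ContinuousOn (fun t => ∫ τ in P.t₀..t, w.1 τ) (Icc P.t₀ P.T) :=
  hw.1.bddMeas.continuousOn_primitive hP.t₀_lt_T.le

theorem continuousOn_traj (hP : P.Regular) (hw : w ∈ P.pcPairs) :
    ContinuousOn (P.traj w.1) (Icc P.t₀ P.T) :=
  continuousOn_const.add (hP.continuousOn_primitive hw)

theorem bddMeas_state (hP : P.Regular) (hw : w ∈ P.pcPairs) :
    BddMeas (fun t => (P.traj w.1 t, w.2 t, t)) P.t₀ P.T :=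
  (hP.continuousOn_traj hw).bddMeas.prodMk (hw.2.bddMeas.prodMk continuousOn_id.bddMeas)

theorem bddMeas_defect (hP : P.Regular) (hw : w ∈ P.pcPairs) : BddMeas (P.defect w) P.t₀ P.T :=
  (hw.1.bddMeas.prodMk ((hP.bddMeas_state hw).comp_continuous hP.continuous_f)).comp_continuous
    (continuous_fst.sub continuous_snd)

theorem bddMeas_fx (hP : P.Regular) (hw : w ∈ P.pcPairs) :
    BddMeas (fun t => P.fx (P.traj w.1 t) (w.2 t) t) P.t₀ P.T :=
  (hP.bddMeas_state hw).comp_continuous hP.continuous_fx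

theorem bddMeas_fu (hP : P.Regular) (hw : w ∈ P.pcPairs) :
    BddMeas (fun t => P.fu (P.traj w.1 t) (w.2 t) t) P.t₀ P.T :=
  (hP.bddMeas_state hw).comp_continuous hP.continuous_fu

theorem bddMeas_linDefect (hP : P.Regular) (hw : w ∈ P.pcPairs) (hh : h ∈ P.pcPairs) :
    BddMeas (P.linDefect w h) P.t₀ P.T := by
  have h1 := (hP.bddMeas_fx hw).prodMk ((hP.continuousOn_primitive hh).bddMeas.prodMk
    ((hP.bddMeas_fu hw).prodMk (hh.1.bddMeas.prodMk hh.2.bddMeas)))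
  exact h1.comp_continuous (F := fun p => p.2.2.2.1 - (p.1 p.2.1 + p.2.2.1 p.2.2.2.2))
    (by fun_prop)

/-- The state depends affinely on the velocity, so only `f` contributes an error to the expansion of
the defect. -/
theorem traj_add_smul (hP : P.Regular) (hw : w ∈ P.pcPairs) (hh : h ∈ P.pcPairs) (ε : ℝ) {t : ℝ}
    (ht : t ∈ Icc P.t₀ P.T) :
    P.traj (w + ε • h).1 t = P.traj w.1 t + ε • ∫ τ in P.t₀..t, h.1 τ := by
  simp only [traj, Prod.fst_add, Prod.smul_fst, Pi.add_apply, Pi.smul_apply]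
  have h1 : IntervalIntegrable (fun τ => ε • h.1 τ) volume P.t₀ t :=
    (hP.intervalIntegrable_fst hh ht).smul ε
  rw [intervalIntegral.integral_add (hP.intervalIntegrable_fst hw ht) h1,
    intervalIntegral.integral_smul, add_assoc]

theorem linDefect_add (hP : P.Regular) (hh : h ∈ P.pcPairs) (hh' : h' ∈ P.pcPairs) {t : ℝ}
    (ht : t ∈ Icc P.t₀ P.T) :
    P.linDefect w (h + h') t = P.linDefect w h t + P.linDefect w h' t := by
  simp only [linDefect, Prod.fst_add, Prod.snd_add, Pi.add_apply]
  rw [intervalIntegral.integral_add (hP.intervalIntegrable_fst hh ht)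
    (hP.intervalIntegrable_fst hh' ht), map_add, map_add]
  abel

end Regular

end MayerProblem

/-! ### The penalty term as a convex function of a differentiable state. -/

namespace MayerProblem

variable {n m : ℕ} {E I : Type*} {P : MayerProblem n m E I}
  {w h : VelCtrl n m}

variable (P) in
/-- The defect and the values of the terminal constraints: the data of which the penalty term is
a convex function. -/
def penaltyState (w : VelCtrl n m) :
    Lp (Vec n) 2 (volume.restrict (Icc P.t₀ P.T)) × (E → ℝ) × (I → ℝ) :=
  (toL2 P.t₀ P.T (P.defect w), fun k => P.ΦE k (P.traj w.1 P.T) P.T,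
    fun j => P.ΦI j (P.traj w.1 P.T) P.T)

/-- The convex function that turns `penaltyState` into the penalty term. -/
def penaltyNorm {H : Type*} [NormedAddCommGroup H] (y : H × (E → ℝ) × (I → ℝ)) : ℝ :=
  ‖y.1‖ + posMax y.2.1 y.2.2

section PenaltyNorm

variable {H : Type*} [NormedAddCommGroup H] [Fintype E] [Fintype I]

theorem penaltyNorm_add_le (y y' : H × (E → ℝ) × (I → ℝ)) :
    penaltyNorm (y + y') ≤ penaltyNorm y + penaltyNorm y' := by
  have h1 := norm_add_le y.1 y'.1
  have h2 := posMax_add_le y.2.1 y'.2.1 y.2.2 y'.2.2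
  simp only [penaltyNorm, Prod.fst_add, Prod.snd_add]
  linarith

theorem penaltyNorm_le (y : H × (E → ℝ) × (I → ℝ)) : penaltyNorm y ≤ 2 * ‖y‖ := by
  have h1 := norm_fst_le y
  have h2 := (posMax_le_norm y.2.1 y.2.2).trans (norm_snd_le y)
  simp only [penaltyNorm]
  linarith

/-- Subadditivity turns a bound into a Lipschitz estimate; the constant `2` counts the two summands,
each at most the sup norm of the product. -/
theorem abs_penaltyNorm_sub_le (y y' : H × (E → ℝ) × (I → ℝ)) :
    |penaltyNorm y - penaltyNorm y'| ≤ 2 * ‖y - y'‖ := by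
  have key : ∀ y y' : H × (E → ℝ) × (I → ℝ), penaltyNorm y - penaltyNorm y' ≤ 2 * ‖y - y'‖ := by
    intro y y'
    have h1 := penaltyNorm_add_le y' (y - y')
    rw [add_sub_cancel] at h1
    linarith [penaltyNorm_le (y - y')]
  refine abs_le.2 ⟨?_, key y y'⟩
  have := key y' y
  rw [norm_sub_rev] at this
  linarith

theorem convexOn_penaltyNorm [NormedSpace ℝ H] :
    ConvexOn ℝ univ (penaltyNorm : H × (E → ℝ) × (I → ℝ) → ℝ) := by
  refine ⟨convex_univ, fun x _ y _ a b ha hb _ => ?_⟩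
  refine (penaltyNorm_add_le _ _).trans (add_le_add ?_ ?_)
  · simp only [penaltyNorm, Prod.smul_fst, Prod.smul_snd, norm_smul, Real.norm_of_nonneg ha,
      smul_eq_mul, mul_add]
    exact add_le_add le_rfl (posMax_smul_le ha _ _)
  · simp only [penaltyNorm, Prod.smul_fst, Prod.smul_snd, norm_smul, Real.norm_of_nonneg hb,
      smul_eq_mul, mul_add]
    exact add_le_add le_rfl (posMax_smul_le hb _ _)

end PenaltyNorm

variable (P) in
theorem phiTerm_eq_posMax (w : VelCtrl n m) :
    P.phiTerm w = posMax (fun k => P.ΦE k (P.traj w.1 P.T) P.T)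
      (fun j => P.ΦI j (P.traj w.1 P.T) P.T) := rfl

variable (P) in
theorem phi_nonneg (w : VelCtrl n m) : 0 ≤ P.phi w :=
  add_nonneg (Real.sqrt_nonneg _) (posMax_nonneg _ _)

namespace Regular

theorem phiDiff_eq_norm (hP : P.Regular) (hw : w ∈ P.pcPairs) :
    P.phiDiff w = ‖toL2 P.t₀ P.T (P.defect w)‖ :=
  (norm_toL2 hP.t₀_lt_T.le ((hP.bddMeas_defect hw).memLp 2)).symm

theorem phi_eq_penaltyNorm (hP : P.Regular) (hw : w ∈ P.pcPairs) :
    P.phi w = penaltyNorm (P.penaltyState w) := by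
  rw [phi, hP.phiDiff_eq_norm hw, phiTerm_eq_posMax]
  rfl

/-- The endpoint variation `∫ h.1` as a linear map. -/
def endpointLin (hP : P.Regular) : P.pcPairs →ₗ[ℝ] Vec n where
  toFun h := ∫ τ in P.t₀..P.T, h.1.1 τ
  map_add' h h' := intervalIntegral.integral_add (hP.intervalIntegrable_fst h.2 hP.right_mem)
    (hP.intervalIntegrable_fst h'.2 hP.right_mem)
  map_smul' c _ := intervalIntegral.integral_smul c _

/-- The linearized defect as a linear map into `L²`. -/
def defectLin (hP : P.Regular) (hw : w ∈ P.pcPairs) :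
    P.pcPairs →ₗ[ℝ] Lp (Vec n) 2 (volume.restrict (Icc P.t₀ P.T)) where
  toFun h := toL2 P.t₀ P.T (P.linDefect w h)
  map_add' h h' := by
    rw [← toL2_add ((hP.bddMeas_linDefect hw h.2).memLp 2)
      ((hP.bddMeas_linDefect hw h'.2).memLp 2)]
    exact toL2_congr fun t ht => hP.linDefect_add h.2 h'.2 ht
  map_smul' c h := by
    rw [RingHom.id_apply, ← toL2_smul ((hP.bddMeas_linDefect hw h.2).memLp 2)]
    exact toL2_congr fun t _ => linDefect_smul c t

/-- The derivative of `penaltyState` at `w`. -/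
def penaltyLin (hP : P.Regular) (hw : w ∈ P.pcPairs) :
    P.pcPairs →ₗ[ℝ] Lp (Vec n) 2 (volume.restrict (Icc P.t₀ P.T)) × (E → ℝ) × (I → ℝ) :=
  (hP.defectLin hw).prod
    ((LinearMap.pi fun k => (fderiv ℝ (fun y => P.ΦE k y P.T) (P.traj w.1 P.T) : Vec n →ₗ[ℝ] ℝ).comp
      hP.endpointLin).prod
    (LinearMap.pi fun j => (fderiv ℝ (fun y => P.ΦI j y P.T) (P.traj w.1 P.T) : Vec n →ₗ[ℝ] ℝ).comp
      hP.endpointLin))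

/-- The state, the control, their variations and the time stay in one compact ball, so the uniform
Taylor estimate applies; the velocity terms cancel exactly. -/
theorem eventually_defect_taylor (hP : P.Regular) (hw : w ∈ P.pcPairs) (hh : h ∈ P.pcPairs)
    {η : ℝ} (hη : 0 < η) :
    ∀ᶠ ε : ℝ in 𝓝[>] 0, ∀ t ∈ Icc P.t₀ P.T,
      ‖P.defect (w + ε • h) t - P.defect w t - ε • P.linDefect w h t‖ ≤ η * ε := by
  obtain ⟨-, C, hC⟩ := (hP.continuousOn_traj hw).bddMeas.prodMk
    ((hP.continuousOn_primitive hh).bddMeas.prodMk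
      (hw.2.bddMeas.prodMk (hh.2.bddMeas.prodMk continuousOn_id.bddMeas)))
  filter_upwards [eventually_forall_norm_taylor_le hP.differentiable_x hP.differentiable_u
    hP.continuous_fx hP.continuous_fu (isCompact_closedBall (0 : Vec n × Vec n × Vec m × Vec m × ℝ) C)
    hη] with ε hε t ht
  have := hε _ (by simpa only [mem_closedBall_zero_iff] using hC t ht)
  -- The defect contains `-f`, so its remainder is minus that of `f`.
  rw [← norm_neg]
  convert! this using 2
  unfold defect
  rw [hP.traj_add_smul hw hh ε ht]
  simp only [linDefect, fx, fu, Prod.fst_add, Prod.snd_add,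
    Prod.smul_fst, Prod.smul_snd, Pi.add_apply, Pi.smul_apply, id_eq, smul_sub, smul_add]
  abel

theorem hasDerivWithinAt_terminal (hP : P.Regular) (hw : w ∈ P.pcPairs) (hh : h ∈ P.pcPairs)
    {Φ : Vec n → ℝ → ℝ} (hΦ : ContDiff ℝ 1 fun y => Φ y P.T) :
    HasDerivWithinAt (fun ε : ℝ => Φ (P.traj (w + ε • h).1 P.T) P.T)
      (fderiv ℝ (fun y => Φ y P.T) (P.traj w.1 P.T) (∫ τ in P.t₀..P.T, h.1 τ)) (Ioi 0) 0 := by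
  simp only [fun ε : ℝ => hP.traj_add_smul hw hh ε hP.right_mem]
  have h1 : HasDerivAt (fun ε : ℝ => P.traj w.1 P.T + ε • ∫ τ in P.t₀..P.T, h.1 τ)
      (∫ τ in P.t₀..P.T, h.1 τ) 0 := by
    simpa using ((hasDerivAt_id (0 : ℝ)).smul_const (∫ τ in P.t₀..P.T, h.1 τ)).const_add
      (P.traj w.1 P.T)
  have h2 := ((hΦ.differentiable one_ne_zero) (P.traj w.1 P.T)).hasFDerivAt
  have h3 : P.traj w.1 P.T = P.traj w.1 P.T + (0 : ℝ) • ∫ τ in P.t₀..P.T, h.1 τ := by simp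
  rw [h3] at h2
  have h4 := (h2.comp_hasDerivAt (0 : ℝ) h1).hasDerivWithinAt (s := Ioi 0)
  rw [← h3] at h4
  exact h4

variable [Fintype E] [Fintype I]

theorem hasDerivWithinAt_penaltyState (hP : P.Regular) (hw : w ∈ P.pcPairs) (h : P.pcPairs) :
    HasDerivWithinAt (fun ε : ℝ => P.penaltyState (w + ε • (h : VelCtrl n m)))
      (hP.penaltyLin hw h) (Ioi 0) 0 := by
  refine HasDerivWithinAt.prodMk ?_ (HasDerivWithinAt.prodMk ?_ ?_)
  · refine hasDerivWithinAt_toL2 hP.t₀_lt_T.le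
      (fun ε => hP.bddMeas_defect (P.pcPairs.add_mem hw (P.pcPairs.smul_mem ε h.2)))
      (hP.bddMeas_linDefect hw h.2) fun η hη => ?_
    simpa using hP.eventually_defect_taylor hw h.2 hη
  · exact hasDerivWithinAt_pi.2 fun k => hP.hasDerivWithinAt_terminal hw h.2 (hP.contDiff_ΦE k)
  · exact hasDerivWithinAt_pi.2 fun k => hP.hasDerivWithinAt_terminal hw h.2 (hP.contDiff_ΦI k)

/-- First order expansion of the penalty term. -/
theorem eventually_abs_phi_sub_le (hP : P.Regular) (hw : w ∈ P.pcPairs) (h : P.pcPairs) {η : ℝ}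
    (hη : 0 < η) :
    ∀ᶠ ε : ℝ in 𝓝[>] 0, |P.phi (w + ε • (h : VelCtrl n m)) -
      penaltyNorm (P.penaltyState w + ε • hP.penaltyLin hw h)| ≤ η * ε := by
  have h1 := hP.hasDerivWithinAt_penaltyState hw h
  rw [hasDerivWithinAt_iff_isLittleO, Asymptotics.isLittleO_iff] at h1
  -- Half of `η` compensates the Lipschitz constant `2` of `penaltyNorm`.
  filter_upwards [h1 (half_pos hη), self_mem_nhdsWithin] with ε hε hε0
  have hε0 : 0 < ε := hε0
  rw [hP.phi_eq_penaltyNorm (P.pcPairs.add_mem hw (P.pcPairs.smul_mem ε h.2))]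
  refine (abs_penaltyNorm_sub_le _ _).trans ?_
  simp only [zero_smul, add_zero, sub_zero, Real.norm_of_nonneg hε0.le] at hε
  rw [← sub_sub]
  linarith

/-- Needed to keep perturbed points inside the band `0 < φ < δ` where the cost is Lipschitz. -/
theorem tendsto_phi (hP : P.Regular) (hw : w ∈ P.pcPairs) (hh : h ∈ P.pcPairs) :
    Tendsto (fun ε : ℝ => P.phi (w + ε • h)) (𝓝[>] 0) (𝓝 (P.phi w)) := by
  have h1 := (hP.hasDerivWithinAt_penaltyState hw ⟨h, hh⟩).continuousWithinAt.tendsto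
  simp only [zero_smul, add_zero] at h1
  have hc : Continuous (penaltyNorm :
      Lp (Vec n) 2 (volume.restrict (Icc P.t₀ P.T)) × (E → ℝ) × (I → ℝ) → ℝ) :=
    (LipschitzWith.of_dist_le_mul (K := 2) fun x y => by
      rw [Real.dist_eq, dist_eq_norm]
      exact abs_penaltyNorm_sub_le x y).continuous
  have h2 := (hc.tendsto _).comp h1
  rw [← hP.phi_eq_penaltyNorm hw] at h2
  refine h2.congr fun ε => ?_
  exact (hP.phi_eq_penaltyNorm (P.pcPairs.add_mem hw (P.pcPairs.smul_mem ε hh))).symm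

end Regular

end MayerProblem

/-! ### Directions, subgradients and exactness of the penalty. -/

namespace MayerProblem

variable {n m : ℕ} {E I : Type*} {P : MayerProblem n m E I} {w h h' : VelCtrl n m}

theorem directions_subset_pcPairs (hw : w ∈ P.domain) (hh : h ∈ P.directions w) :
    h ∈ P.pcPairs := by
  obtain ⟨ε, hε, h1⟩ := hh
  have h2 := P.pcPairs.sub_mem (P.domain_subset_pcPairs (h1 ε ⟨hε.le, le_rfl⟩))
    (P.domain_subset_pcPairs hw)
  have h3 := P.pcPairs.smul_mem ε⁻¹ h2
  rwa [add_sub_cancel_left, inv_smul_smul₀ hε.ne'] at h3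

theorem zero_mem_directions (hw : w ∈ P.domain) : (0 : VelCtrl n m) ∈ P.directions w :=
  ⟨1, one_pos, fun ε _ => by simpa using hw⟩

theorem smul_mem_directions {c : ℝ} (hc : 0 < c) (hh : h ∈ P.directions w) :
    c • h ∈ P.directions w := by
  obtain ⟨ε₀, hε₀, h1⟩ := hh
  refine ⟨ε₀ / c, by positivity, fun ε hε => ?_⟩
  rw [smul_smul]
  exact h1 _ ⟨mul_nonneg hε.1 hc.le, (le_div_iff₀ hc).1 hε.2⟩

theorem convex_domain (hV : Convex ℝ P.V) : Convex ℝ P.domain := by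
  intro x hx y hy a b ha hb hab
  refine ⟨(hx.1.const_smul a).add (hy.1.const_smul b), (hx.2.1.const_smul a).add
    (hy.2.1.const_smul b), fun t ht => hV (hx.2.2 t ht) (hy.2.2 t ht) ha hb hab⟩

/-- The point `w + ε • (h + h')` is the midpoint of `w + 2ε • h` and `w + 2ε • h'`, and the domain
is convex when `V` is. -/
theorem add_mem_directions (hV : Convex ℝ P.V) (hh : h ∈ P.directions w)
    (hh' : h' ∈ P.directions w) : h + h' ∈ P.directions w := by
  obtain ⟨ε₁, hε₁, h1⟩ := hh
  obtain ⟨ε₂, hε₂, h2⟩ := hh'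
  refine ⟨min ε₁ ε₂ / 2, by positivity, fun ε hε => ?_⟩
  have hle : 2 * ε ≤ min ε₁ ε₂ := by linarith [hε.2]
  have e0 : 0 ≤ 2 * ε := by linarith [hε.1]
  have := convex_domain hV (h1 (2 * ε) ⟨e0, hle.trans (min_le_left _ _)⟩)
    (h2 (2 * ε) ⟨e0, hle.trans (min_le_right _ _)⟩) one_half_pos.le one_half_pos.le (add_halves 1)
  convert! this using 1
  module

/-- The Hilbert space of square integrable pairs. -/
abbrev PairL2 (P : MayerProblem n m E I) : Type :=
  WithLp 2 (Lp (Vec n) 2 (volume.restrict (Icc P.t₀ P.T)) ×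
    Lp (Vec m) 2 (volume.restrict (Icc P.t₀ P.T)))

variable (P) in
/-- The class in `L²` of a piecewise continuous pair. -/
def pairLin : P.pcPairs →ₗ[ℝ] P.PairL2 where
  toFun h := WithLp.toLp 2 (toL2 P.t₀ P.T h.1.1, toL2 P.t₀ P.T h.1.2)
  map_add' h h' := by
    rw [← WithLp.toLp_add, Prod.mk_add_mk, ← toL2_add (h.2.1.bddMeas.memLp 2)
      (h'.2.1.bddMeas.memLp 2), ← toL2_add (h.2.2.bddMeas.memLp 2) (h'.2.2.bddMeas.memLp 2)]
    rfl
  map_smul' c h := by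
    rw [RingHom.id_apply, ← WithLp.toLp_smul, Prod.smul_mk, ← toL2_smul (h.2.1.bddMeas.memLp 2),
      ← toL2_smul (h.2.2.bddMeas.memLp 2)]
    rfl

theorem intervalIntegrable_norm_sq {k : ℕ} {a b : ℝ} (hab : a ≤ b) {g : ℝ → Vec k}
    (hg : MemLp g 2 (volume.restrict (Icc a b))) :
    IntervalIntegrable (fun t => ‖g t‖ ^ 2) volume a b := by
  rw [intervalIntegrable_iff_integrableOn_Icc_of_le hab]
  exact hg.integrable_norm_pow (by norm_num)

theorem intervalIntegrable_inner {k : ℕ} {a b : ℝ} (hab : a ≤ b) {g g' : ℝ → Vec k}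
    (hg : MemLp g 2 (volume.restrict (Icc a b))) (hg' : MemLp g' 2 (volume.restrict (Icc a b))) :
    IntervalIntegrable (fun t => inner ℝ (g t) (g' t)) volume a b := by
  rw [intervalIntegrable_iff_integrableOn_Icc_of_le hab]
  have h : Integrable (fun t => inner ℝ (hg.toLp g t) (hg'.toLp g' t))
      (volume.restrict (Icc a b)) := L2.integrable_inner _ _
  refine h.congr ?_
  filter_upwards [hg.coeFn_toLp, hg'.coeFn_toLp] with t h1 h2
  rw [h1, h2]

namespace Regular

theorem normL2_eq_norm (hP : P.Regular) {p : VelCtrl n m}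
    (h1 : MemLp p.1 2 (volume.restrict (Icc P.t₀ P.T)))
    (h2 : MemLp p.2 2 (volume.restrict (Icc P.t₀ P.T))) :
    P.normL2 p = ‖(WithLp.toLp 2 (toL2 P.t₀ P.T p.1, toL2 P.t₀ P.T p.2) : P.PairL2)‖ := by
  have hab := hP.t₀_lt_T.le
  rw [normL2, WithLp.prod_norm_eq_of_L2, WithLp.toLp_fst, WithLp.toLp_snd, norm_toL2_sq hab h1, norm_toL2_sq hab h2,
    intervalIntegral.integral_add (intervalIntegrable_norm_sq hab h1)
      (intervalIntegrable_norm_sq hab h2)]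

theorem pairing_eq_inner (hP : P.Regular) {p q : VelCtrl n m}
    (h1 : MemLp p.1 2 (volume.restrict (Icc P.t₀ P.T)))
    (h2 : MemLp p.2 2 (volume.restrict (Icc P.t₀ P.T)))
    (h1' : MemLp q.1 2 (volume.restrict (Icc P.t₀ P.T)))
    (h2' : MemLp q.2 2 (volume.restrict (Icc P.t₀ P.T))) :
    P.pairing p q =
      inner ℝ (WithLp.toLp 2 (toL2 P.t₀ P.T p.1, toL2 P.t₀ P.T p.2) : P.PairL2)
        (WithLp.toLp 2 (toL2 P.t₀ P.T q.1, toL2 P.t₀ P.T q.2)) := by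
  have hab := hP.t₀_lt_T.le
  rw [pairing, WithLp.prod_inner_apply, inner_toL2 hab h1 h1', inner_toL2 hab h2 h2',
    intervalIntegral.integral_add (intervalIntegrable_inner hab h1 h1')
      (intervalIntegrable_inner hab h2 h2')]

theorem normL2_smul (hP : P.Regular) (hh : h ∈ P.pcPairs) {ε : ℝ} (hε : 0 ≤ ε) :
    P.normL2 (ε • h) = ε * P.normL2 h := by
  have hh' := P.pcPairs.smul_mem ε hh
  rw [hP.normL2_eq_norm (hh.1.bddMeas.memLp 2) (hh.2.bddMeas.memLp 2),
    hP.normL2_eq_norm (hh'.1.bddMeas.memLp 2) (hh'.2.bddMeas.memLp 2)]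
  change ‖P.pairLin (ε • ⟨h, hh⟩)‖ = ε * ‖P.pairLin ⟨h, hh⟩‖
  rw [map_smul, norm_smul, Real.norm_of_nonneg hε]

variable [Fintype E] [Fintype I]

/-- A zero L² norm makes the defect vanish only almost everywhere, which is all that admissibility
requires of the state equation. -/
theorem mem_admissible_of_phi_eq_zero (hP : P.Regular) (hw : w ∈ P.domain) (h : P.phi w = 0) :
    w ∈ P.admissible := by
  have hpc := P.domain_subset_pcPairs hw
  have h1 : 0 ≤ P.phiDiff w := Real.sqrt_nonneg _
  have h2 : 0 ≤ P.phiTerm w := posMax_nonneg _ _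
  have hd : P.phiDiff w = 0 := by rw [phi] at h; linarith
  have ht : P.phiTerm w = 0 := by rw [phi] at h; linarith
  rw [hP.phiDiff_eq_norm hpc, norm_eq_zero, toL2_of_memLp ((hP.bddMeas_defect hpc).memLp 2)] at hd
  rw [phiTerm_eq_posMax] at ht
  obtain ⟨-, hE, hI⟩ := posMax_le_iff.1 ht.le
  refine ⟨hw, ?_, fun k => abs_nonpos_iff.1 (hE k), hI⟩
  filter_upwards [((hP.bddMeas_defect hpc).memLp 2).coeFn_toLp,
    Lp.coeFn_zero (Vec n) 2 (volume.restrict (Icc P.t₀ P.T))] with t h3 h4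
  rw [hd, h4] at h3
  exact sub_eq_zero.1 h3.symm

theorem phi_eq_zero_of_mem_admissible (hP : P.Regular) (hw : w ∈ P.admissible) :
    P.phi w = 0 := by
  have hpc := P.domain_subset_pcPairs hw.1
  have hd : P.phiDiff w = 0 := by
    rw [hP.phiDiff_eq_norm hpc, norm_eq_zero, toL2_of_memLp ((hP.bddMeas_defect hpc).memLp 2),
      ← MemLp.toLp_zero (MemLp.zero' (p := 2)), MemLp.toLp_eq_toLp_iff]
    filter_upwards [hw.2.1] with t ht
    exact sub_eq_zero.2 ht
  have ht : P.phiTerm w = 0 := by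
    rw [phiTerm_eq_posMax]
    exact le_antisymm (posMax_le_iff.2 ⟨le_rfl, fun k => by rw [hw.2.2.1 k, abs_zero], hw.2.2.2⟩)
      (posMax_nonneg _ _)
  rw [phi, hd, ht, add_zero]

/-- A lower bound `-r‖·‖` for the directional derivatives of the penalty term produces a
subgradient of norm at most `r`. -/
theorem exists_mem_subdiffPhi (hP : P.Regular) (hV : Convex ℝ P.V) (hw : w ∈ P.domain) {r : ℝ}
    (hr : 0 ≤ r) (hlow : ∀ h ∈ P.directions w, ∀ᶠ ε : ℝ in 𝓝[>] 0,
      -(ε * (r * P.normL2 h)) ≤ P.phi (w + ε • h) - P.phi w) :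
    ∃ p ∈ P.subdiffPhi w, P.normL2 p ≤ r := by
  have hpc := P.domain_subset_pcPairs hw
  obtain ⟨p, hpr, hp⟩ := exists_subgradient_of_cone (convexOn_penaltyNorm (E := E) (I := I))
    (P.penaltyState w) {h : P.pcPairs | (h : VelCtrl n m) ∈ P.directions w}
    (zero_mem_directions hw) (fun x hx y hy => add_mem_directions hV hx hy)
    (fun c hc x hx => smul_mem_directions hc hx) P.pairLin (hP.penaltyLin hpc) hr (by
      intro h hh η hη
      filter_upwards [hlow h hh, hP.eventually_abs_phi_sub_le hpc h hη] with ε h1 h2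
      rw [hP.normL2_eq_norm (h.2.1.bddMeas.memLp 2) (h.2.2.bddMeas.memLp 2)] at h1
      rw [← hP.phi_eq_penaltyNorm hpc]
      have h3 := (abs_le.1 h2).2
      change -(ε * (r * ‖P.pairLin h‖)) ≤ _ at h1
      linarith)
  have m1 := Lp.memLp p.fst
  have m2 := Lp.memLp p.snd
  have hpe : (WithLp.toLp 2 (toL2 P.t₀ P.T p.fst, toL2 P.t₀ P.T p.snd) : P.PairL2) = p := by
    rw [toL2_coeFn, toL2_coeFn]
    rfl
  refine ⟨(p.fst, p.snd), ⟨m1, m2, fun h hh c hc => ?_⟩, ?_⟩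
  · have hhpc := directions_subset_pcPairs hw hh
    rw [hP.pairing_eq_inner m1 m2 (hhpc.1.bddMeas.memLp 2) (hhpc.2.bddMeas.memLp 2), hpe] at hc
    -- The gap between the pairing and `c` absorbs the first-order error of the penalty term.
    filter_upwards [hP.eventually_abs_phi_sub_le hpc ⟨h, hhpc⟩ (sub_pos.2 hc),
      self_mem_nhdsWithin] with ε h1 h2
    have h2 : 0 < ε := h2
    rw [le_div_iff₀ h2]
    have h3 := hp ⟨h, hhpc⟩ hh ε h2
    rw [← hP.phi_eq_penaltyNorm hpc] at h3
    have h4 := (abs_le.1 h1).1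
    change ε * inner ℝ p (WithLp.toLp 2 (toL2 P.t₀ P.T h.1, toL2 P.t₀ P.T h.2) : P.PairL2) ≤ _
      at h3
    linarith
  · rw [hP.normL2_eq_norm m1 m2, hpe]
    exact hpr

/-- Where the separation condition holds and the cost is Lipschitz, minimizers of a penalty
function with a large parameter satisfy the constraints. -/
theorem phi_eq_zero_of_minimizer (hP : P.Regular) (hV : Convex ℝ P.V) {a δ L lam : ℝ}
    (husc : ∀ w ∈ P.domain, 0 < P.phi w → P.phi w < δ → ∀ p ∈ P.subdiffPhi w, a ≤ P.normL2 p)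
    (hL : 0 ≤ L) (hlip : ∀ w ∈ P.domain, ∀ w' ∈ P.domain, 0 < P.phi w → P.phi w < δ →
      0 < P.phi w' → P.phi w' < δ → |P.J w - P.J w'| ≤ L * P.normL2 (w - w'))
    (hlam : 0 < lam) (hLlam : L < a * lam) (hw : w ∈ P.domain)
    (hmin : ∀ w' ∈ P.domain, P.F lam w ≤ P.F lam w') (hδ : P.phi w < δ) : P.phi w = 0 := by
  by_contra hne
  have hpos : 0 < P.phi w := (P.phi_nonneg w).lt_of_ne' hne
  -- Minimality gives `lam * Δφ ≥ -ΔJ ≥ -L * ε * ‖h‖`, whence the slope bound `L / lam`, which lies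
  -- below `a`.
  obtain ⟨p, hp, hpr⟩ := hP.exists_mem_subdiffPhi hV hw (r := L / lam) (by positivity) (by
    intro h hh
    have hhpc := directions_subset_pcPairs hw hh
    have hφ := (hP.tendsto_phi (P.domain_subset_pcPairs hw) hhpc).eventually
      (Ioo_mem_nhds hpos hδ)
    obtain ⟨ε₀, hε₀, hdom⟩ := hh
    filter_upwards [hφ, Ioo_mem_nhdsGT hε₀] with ε h1 h2
    have hd := hdom ε ⟨h2.1.le, h2.2.le⟩
    have h3 := hlip _ hd w hw h1.1 h1.2 hpos hδ
    rw [add_sub_cancel_left, hP.normL2_smul hhpc h2.1.le] at h3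
    have h4 := hmin _ hd
    simp only [F] at h4
    have h5 := (abs_le.1 h3).2
    have h6 : -(L * (ε * P.normL2 h)) ≤ lam * (P.phi (w + ε • h) - P.phi w) := by linarith
    have h7 : -(ε * (L / lam * P.normL2 h)) = (-(L * (ε * P.normL2 h))) / lam := by ring
    rw [h7, div_le_iff₀ hlam, mul_comm _ lam]
    exact h6)
  have h1 := (husc w hw hpos hδ p hp).trans hpr
  rw [le_div_iff₀ hlam] at h1
  linarith

/-- A minimizer with zero penalty is admissible, so the optimal pair costs no more than it; as `F
lam` and the cost agree on admissible pairs, the optimal pair attains both infima. -/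
theorem isExactPenaltyConstant_of_minimizer (hP : P.Regular) {lam : ℝ} (hlam : 0 ≤ lam)
    {ws : VelCtrl n m} (hopt : P.IsOptimal ws) (hw : w ∈ P.domain)
    (hmin : ∀ w' ∈ P.domain, P.F lam w ≤ P.F lam w') (h0 : P.phi w = 0) :
    P.IsExactPenaltyConstant lam ∧ ∀ w' ∈ P.domain, P.F lam ws ≤ P.F lam w' := by
  have hF : ∀ w' ∈ P.admissible, P.F lam w' = P.J w' := fun w' hw' => by
    rw [F, hP.phi_eq_zero_of_mem_admissible hw', mul_zero, add_zero]
  have hwa := hP.mem_admissible_of_phi_eq_zero hw h0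
  have hglob : ∀ w' ∈ P.domain, P.F lam ws ≤ P.F lam w' := fun w' hw' => by
    rw [hF ws hopt.1]
    exact (hopt.2 w hwa).trans ((hF w hwa).symm.le.trans (hmin w' hw'))
  refine ⟨⟨hlam, le_antisymm ?_ ?_⟩, hglob⟩
  · refine le_iInf₂ fun w' hw' => (iInf₂_le w' hw'.1).trans ?_
    rw [hF w' hw']
  · refine le_iInf₂ fun w' hw' => (iInf₂_le ws hopt.1).trans ?_
    rw [← hF ws hopt.1]
    exact EReal.coe_le_coe_iff.2 (hglob w' hw')

/-- Exactness of the penalty function under the separation condition. -/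
theorem exists_exactPenaltyConstant (hP : P.Regular) (hV : Convex ℝ P.V) (husc : P.USC)
    (hbdd : P.CostBoundedBelow) (hatt : P.PenaltyAttained) (hlip : P.CostLipschitz)
    {ws : VelCtrl n m} (hopt : P.IsOptimal ws) :
    ∃ lam₁ : ℝ, P.IsExactPenaltyConstant lam₁ ∧ ∀ lam > lam₁,
      P.IsExactPenaltyConstant lam ∧
      (∀ w ∈ P.domain, P.F lam ws ≤ P.F lam w) ∧ P.IsLocalMinimizer lam ws := by
  obtain ⟨a, ha, δ, hδ, husc⟩ := husc
  obtain ⟨c, hc⟩ := hbdd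
  obtain ⟨lam₀, hatt⟩ := hatt
  obtain ⟨δ', hδ', L, hL⟩ := hlip
  set d := min δ δ' with hd
  have hd0 : 0 < d := lt_min hδ hδ'
  have key : ∀ lam, lam₀ ≤ lam → 0 < lam → max L 0 < a * lam → P.J ws - c < d * lam →
      P.IsExactPenaltyConstant lam ∧ ∀ w' ∈ P.domain, P.F lam ws ≤ P.F lam w' := by
    intro lam h1 h2 h3 h4
    obtain ⟨w, hw, hmin⟩ := hatt lam h1
    refine hP.isExactPenaltyConstant_of_minimizer h2.le hopt hw hmin ?_
    refine hP.phi_eq_zero_of_minimizer hV (δ := d) (a := a) (L := max L 0) (lam := lam)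
      (fun w hw hp hp' => husc w hw hp (hp'.trans_le (min_le_left _ _))) (le_max_right _ _)
      (fun w hw w' hw' e1 e2 e3 e4 =>
        (hL w hw w' hw' e1 (e2.trans_le (min_le_right _ _)) e3 (e4.trans_le (min_le_right _ _))).trans
          (mul_le_mul_of_nonneg_right (le_max_left _ _) (Real.sqrt_nonneg _))) h2 h3 hw hmin ?_
    -- Comparison with the optimal pair and the lower bound `c` give `lam * φ w ≤ J ws - c < d *
    -- lam`, so `w` lies in the band.
    have h5 := hmin ws hopt.1.1
    simp only [F, hP.phi_eq_zero_of_mem_admissible hopt.1] at h5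
    have h6 := hc w hw
    have h7 : P.phi w * lam < d * lam := by linarith
    exact lt_of_mul_lt_mul_right h7 h2.le
  -- The entries secure attainment, positivity, the slope comparison with `a`, and the bound `φ <
  -- d`; the `+ 1` makes the last two strict even at `lam₁` itself.
  set lam₁ := max (max lam₀ 1) (max (max L 0 / a + 1) ((P.J ws - c) / d + 1)) with hlam₁
  have key' : ∀ lam ≥ lam₁,
      P.IsExactPenaltyConstant lam ∧ ∀ w' ∈ P.domain, P.F lam ws ≤ P.F lam w' := by
    intro lam hlam
    have e1 : max lam₀ 1 ≤ lam := (le_max_left _ _).trans hlam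
    have e2 : max (max L 0 / a + 1) ((P.J ws - c) / d + 1) ≤ lam := (le_max_right _ _).trans hlam
    have e3 : max L 0 / a + 1 ≤ lam := (le_max_left _ _).trans e2
    have e4 : (P.J ws - c) / d + 1 ≤ lam := (le_max_right _ _).trans e2
    refine key lam ((le_max_left _ _).trans e1)
      (one_pos.trans_le ((le_max_right _ _).trans e1)) ?_ ?_
    · rw [mul_comm, ← div_lt_iff₀ ha]
      linarith
    · rw [mul_comm, ← div_lt_iff₀ hd0]
      linarith
  refine ⟨lam₁, (key' lam₁ le_rfl).1, fun lam hlam => ?_⟩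
  obtain ⟨h1, h2⟩ := key' lam hlam.le
  exact ⟨h1, h2, hopt.1.1, 1, one_pos, fun w' hw' _ => h2 w' hw'⟩

end Regular

end MayerProblem

/-! ### The du Bois-Reymond lemma and the weak adjoint equation. -/

section DuBoisReymond

/-- A fundamental lemma of the calculus of variations in integrated form. -/
theorem ae_eq_neg_add_integral_of_forall_integral_eq_zero {a b c : ℝ} (hab : a ≤ b) {s g : ℝ → ℝ}
    (hs : IntervalIntegrable s volume a b) (hg : IntervalIntegrable g volume a b)
    (h : ∀ φ : ℝ → ℝ, Continuous φ →
      (∫ t in a..b, (φ t * s t - g t * ∫ τ in a..t, φ τ)) + c * ∫ t in a..b, φ t = 0) :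
    ∀ᵐ t ∂volume.restrict (Icc a b), s t = -c + ∫ τ in t..b, g τ := by
  set F : ℝ → ℝ := fun t => s t + c - ∫ τ in t..b, g τ with hF
  have hG : ContinuousOn (fun t => ∫ τ in t..b, g τ) (uIcc a b) := by
    have h1 : IntegrableOn g (uIcc a b) := by
      rwa [uIcc_of_le hab, ← intervalIntegrable_iff_integrableOn_Icc_of_le hab]
    exact intervalIntegral.continuousOn_primitive_interval_left h1
  have hFint : IntervalIntegrable F volume a b :=
    (hs.add intervalIntegrable_const).sub hG.intervalIntegrable
  have hFon : IntegrableOn F (Icc a b) :=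
    (intervalIntegrable_iff_integrableOn_Icc_of_le hab).1 hFint
  have hzero : ∀ φ : ℝ → ℝ, Continuous φ → ∫ t in a..b, φ t * F t = 0 := by
    intro φ hφ
    have hφi : IntervalIntegrable φ volume a b := hφ.intervalIntegrable _ _
    have hφp : Continuous fun t => ∫ τ in a..t, φ τ :=
      intervalIntegral.continuous_primitive (fun _ _ => hφ.intervalIntegrable _ _) a
    -- The primitive of `g` starts at `b` and that of `φ` at `a`, so both boundary terms vanish.
    -- Since `g` is only integrable, integration by parts is used for absolutely continuous
    -- functions.
    have acg := hg.absolutelyContinuousOnInterval_intervalIntegral (c := b) (by simp)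
    have acφ := hφi.absolutelyContinuousOnInterval_intervalIntegral (c := a) (by simp)
    have ibp := acg.integral_mul_deriv_eq_deriv_mul acφ
    have d1 : ∫ t in a..b, (∫ τ in b..t, g τ) * deriv (fun t => ∫ τ in a..t, φ τ) t =
        ∫ t in a..b, (∫ τ in b..t, g τ) * φ t :=
      intervalIntegral.integral_congr fun t _ => by
        simp only [hφ.deriv_integral]
    have d2 : ∫ t in a..b, deriv (fun t => ∫ τ in b..t, g τ) t * ∫ τ in a..t, φ τ =
        ∫ t in a..b, g t * ∫ τ in a..t, φ τ := by
      refine intervalIntegral.integral_congr_ae ?_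
      filter_upwards [hg.ae_hasDerivAt_integral] with t ht hmem
      rw [(ht (uIoc_subset_uIcc hmem) b (by simp)).deriv]
    rw [d1, d2, intervalIntegral.integral_same, intervalIntegral.integral_same] at ibp
    have i1 : IntervalIntegrable (fun t => φ t * s t) volume a b :=
      hs.continuousOn_mul hφ.continuousOn
    have i2 : IntervalIntegrable (fun t => g t * ∫ τ in a..t, φ τ) volume a b :=
      hg.mul_continuousOn hφp.continuousOn
    have i3 : IntervalIntegrable (fun t => (∫ τ in b..t, g τ) * φ t) volume a b := by
      refine ContinuousOn.intervalIntegrable (ContinuousOn.mul ?_ hφ.continuousOn)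
      simp only [fun t => intervalIntegral.integral_symm (f := g) (μ := volume) t b]
      exact hG.neg
    have key := h φ hφ
    rw [intervalIntegral.integral_sub i1 i2] at key
    have expand : ∀ t, φ t * F t = φ t * s t + c * φ t + (∫ τ in b..t, g τ) * φ t := fun t => by
      simp only [hF]
      rw [intervalIntegral.integral_symm b t]
      ring
    simp only [expand]
    rw [intervalIntegral.integral_add (i1.add (hφi.const_mul c)) i3,
      intervalIntegral.integral_add i1 (hφi.const_mul c), intervalIntegral.integral_const_mul]
    linarith
  have hind : Integrable (indicator (Icc a b) F) := hFon.integrable_indicator measurableSet_Icc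
  have hae := ae_eq_zero_of_integral_contDiff_smul_eq_zero hind.locallyIntegrable
    (fun φ hφ _ => by
      have h1 := hzero φ hφ.continuous
      rw [intervalIntegral.integral_of_le hab, ← integral_Icc_eq_integral_Ioc,
        ← integral_indicator measurableSet_Icc] at h1
      rw [← h1]
      refine integral_congr_ae (ae_of_all _ fun t => ?_)
      by_cases ht : t ∈ Icc a b <;> simp [ht])
  rw [ae_restrict_iff' measurableSet_Icc]
  filter_upwards [hae] with t ht hmem
  rw [indicator_of_mem hmem] at ht
  simp only [hF] at ht
  linarith

end DuBoisReymond

section AdjointEquation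

variable {n : ℕ} {a b : ℝ}

theorem continuous_adjoint {k : ℕ} :
    Continuous fun A : Vec k →L[ℝ] Vec n => ContinuousLinearMap.adjoint A :=
  (ContinuousLinearMap.adjoint (𝕜 := ℝ) (E := Vec k) (F := Vec n)).continuous

theorem norm_adjoint {k : ℕ} (A : Vec k →L[ℝ] Vec n) : ‖ContinuousLinearMap.adjoint A‖ = ‖A‖ :=
  (ContinuousLinearMap.adjoint (𝕜 := ℝ) (E := Vec k) (F := Vec n)).norm_map A

theorem aestronglyMeasurable_adjoint_apply {k : ℕ} {μ : Measure ℝ} {B : ℝ → Vec k →L[ℝ] Vec n}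
    {σ : ℝ → Vec n} (hB : AEStronglyMeasurable B μ) (hσ : AEStronglyMeasurable σ μ) :
    AEStronglyMeasurable (fun t => ContinuousLinearMap.adjoint (B t) (σ t)) μ := by
  have h1 : AEStronglyMeasurable (fun t => ContinuousLinearMap.adjoint (B t)) μ :=
    continuous_adjoint.comp_aestronglyMeasurable hB
  exact (ContinuousLinearMap.id ℝ (Vec n →L[ℝ] Vec k)).aestronglyMeasurable_comp₂ h1 hσ

theorem BddMeas.intervalIntegrable_adjoint_apply (hab : a ≤ b) {B : ℝ → Vec n →L[ℝ] Vec n}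
    (hB : BddMeas B a b) {σ : ℝ → Vec n} (hσ : MemLp σ 2 (volume.restrict (Icc a b))) :
    IntervalIntegrable (fun t => ContinuousLinearMap.adjoint (B t) (σ t)) volume a b := by
  rw [intervalIntegrable_iff_integrableOn_Icc_of_le hab]
  have h1 : Integrable σ (volume.restrict (Icc a b)) := hσ.integrable one_le_two
  obtain ⟨hm, C, hC⟩ := hB
  refine (h1.norm.const_mul C).mono'
    (aestronglyMeasurable_adjoint_apply hm h1.aestronglyMeasurable) ?_
  refine (ae_restrict_iff' measurableSet_Icc).2 (ae_of_all _ fun t ht => ?_)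
  refine (ContinuousLinearMap.le_opNorm _ _).trans
    (mul_le_mul_of_nonneg_right ?_ (norm_nonneg _))
  rw [norm_adjoint]
  exact hC t ht

/-- The weak form of a linear adjoint equation forces its solution to agree almost everywhere with
the solution of the integral equation. -/
theorem ae_eq_adjoint_solution (hab : a ≤ b) {B : ℝ → Vec n →L[ℝ] Vec n} (hB : BddMeas B a b)
    {σ : ℝ → Vec n} (hσ : MemLp σ 2 (volume.restrict (Icc a b))) (q : Vec n)
    (h : ∀ φ : ℝ → ℝ, Continuous φ → ∀ v : Vec n,
      (∫ t in a..b, inner ℝ (σ t) (φ t • v - B t (∫ τ in a..t, φ τ • v))) +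
        inner ℝ q (∫ t in a..b, φ t • v) = 0) :
    ∀ᵐ t ∂volume.restrict (Icc a b),
      σ t = -q + ∫ τ in t..b, ContinuousLinearMap.adjoint (B τ) (σ τ) := by
  have hBσ := hB.intervalIntegrable_adjoint_apply hab hσ
  -- Testing with `φ` times a basis vector and moving `B t` to its adjoint reduces each coordinate
  -- to the scalar lemma.
  have key : ∀ i : Fin n, ∀ᵐ t ∂volume.restrict (Icc a b),
      inner ℝ (EuclideanSpace.single i (1 : ℝ)) (σ t) =
        -inner ℝ q (EuclideanSpace.single i (1 : ℝ)) + ∫ τ in t..b,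
          inner ℝ (EuclideanSpace.single i (1 : ℝ)) (ContinuousLinearMap.adjoint (B τ) (σ τ)) := by
    intro i
    set v : Vec n := EuclideanSpace.single i (1 : ℝ)
    refine ae_eq_neg_add_integral_of_forall_integral_eq_zero hab
      (s := fun t => inner ℝ v (σ t))
      (g := fun t => inner ℝ v (ContinuousLinearMap.adjoint (B t) (σ t))) ?_ ?_ fun φ hφ => ?_
    · rw [intervalIntegrable_iff_integrableOn_Icc_of_le hab]
      exact Integrable.const_inner v (hσ.integrable one_le_two)
    · rw [intervalIntegrable_iff_integrableOn_Icc_of_le hab] at hBσ ⊢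
      exact Integrable.const_inner v hBσ
    · rw [← h φ hφ v, intervalIntegral.integral_smul_const, inner_smul_right, mul_comm (∫ t in a..b, φ t)]
      congr 1
      refine intervalIntegral.integral_congr fun t _ => ?_
      simp only [intervalIntegral.integral_smul_const, map_smul, inner_sub_right, inner_smul_right,
        ContinuousLinearMap.adjoint_inner_right]
      rw [real_inner_comm v (σ t), real_inner_comm (B t v) (σ t), mul_comm (inner ℝ (B t v) (σ t))]
  filter_upwards [ae_all_iff.2 key, ae_restrict_mem measurableSet_Icc] with t ht hmem
  have hBt : IntervalIntegrable (fun t => ContinuousLinearMap.adjoint (B t) (σ t)) volume t b :=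
    hBσ.mono_set (by rw [uIcc_of_le hab, uIcc_of_le hmem.2]; exact Icc_subset_Icc_left hmem.1)
  ext i
  have h1 := ht i
  have h2 : ∫ τ in t..b, inner ℝ (EuclideanSpace.single i (1 : ℝ))
      (ContinuousLinearMap.adjoint (B τ) (σ τ)) = inner ℝ (EuclideanSpace.single i (1 : ℝ))
        (∫ τ in t..b, ContinuousLinearMap.adjoint (B τ) (σ τ)) :=
    (innerSL ℝ (EuclideanSpace.single i (1 : ℝ) : Vec n)).intervalIntegral_comp_comm hBt
  rw [h2] at h1
  simpa [EuclideanSpace.inner_single_left, EuclideanSpace.inner_single_right] using h1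

/-- Regularity of the solution of the weak adjoint equation. -/
theorem exists_adjoint_solution (hab : a < b) {B : ℝ → Vec n →L[ℝ] Vec n} (hB : BddMeas B a b)
    {σ : ℝ → Vec n} (hσ : MemLp σ 2 (volume.restrict (Icc a b))) (q : Vec n)
    (h : ∀ φ : ℝ → ℝ, Continuous φ → ∀ v : Vec n,
      (∫ t in a..b, inner ℝ (σ t) (φ t • v - B t (∫ τ in a..t, φ τ • v))) +
        inner ℝ q (∫ t in a..b, φ t • v) = 0) :
    ∃ ψ : ℝ → Vec n, ContinuousOn ψ (Icc a b) ∧ (∀ᵐ t ∂volume.restrict (Icc a b), σ t = ψ t) ∧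
      ψ b = -q ∧ ∀ t ∈ Icc a b, ContinuousWithinAt B (Icc a b) t →
        HasDerivWithinAt ψ (-(ContinuousLinearMap.adjoint (B t) (ψ t))) (Icc a b) t := by
  set ψ : ℝ → Vec n := fun t => -q + ∫ τ in t..b, ContinuousLinearMap.adjoint (B τ) (σ τ) with hψ
  have hae := ae_eq_adjoint_solution hab.le hB hσ q h
  have hBσ := hB.intervalIntegrable_adjoint_apply hab.le hσ
  have hcont : ContinuousOn ψ (Icc a b) := by
    rw [intervalIntegrable_iff_integrableOn_Icc_of_le hab.le, ← uIcc_of_le hab.le] at hBσ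
    have := intervalIntegral.continuousOn_primitive_interval_left hBσ
    rw [uIcc_of_le hab.le] at this
    exact continuousOn_const.add this
  have hBψ := hB.intervalIntegrable_adjoint_apply hab.le (hcont.bddMeas.memLp 2)
  -- Replacing `σ` by its continuous representative under the integral makes the integrand
  -- continuous wherever `B` is, as the fundamental theorem of calculus requires.
  have hint : ∀ t ∈ Icc a b,
      ψ t = -q + ∫ τ in t..b, ContinuousLinearMap.adjoint (B τ) (ψ τ) := by
    intro t ht
    simp only [hψ]
    congr 1
    refine intervalIntegral.integral_congr_ae ?_
    filter_upwards [(ae_restrict_iff' measurableSet_Icc).1 hae] with τ h1 h2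
    rw [uIoc_of_le ht.2] at h2
    rw [← h1 ⟨ht.1.trans h2.1.le, h2.2⟩]
  refine ⟨ψ, hcont, hae, by simp [hψ], fun t ht hBt => ?_⟩
  -- Lets the fundamental theorem be applied within `Icc a b`, with one-sided derivatives at the
  -- ends.
  have hfact : Fact (t ∈ Icc a b) := ⟨ht⟩
  have hBψt : IntervalIntegrable (fun t => ContinuousLinearMap.adjoint (B t) (ψ t)) volume t b :=
    hBψ.mono_set (by rw [uIcc_of_le hab.le, uIcc_of_le ht.2]; exact Icc_subset_Icc_left ht.1)
  have hc : ContinuousWithinAt (fun τ => ContinuousLinearMap.adjoint (B τ) (ψ τ)) (Icc a b) t :=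
    (continuous_adjoint.continuousAt.comp_continuousWithinAt hBt).clm_apply (hcont t ht)
  have hmeas : StronglyMeasurableAtFilter (fun τ => ContinuousLinearMap.adjoint (B τ) (ψ τ))
      (𝓝[Icc a b] t) volume := by
    refine ⟨Icc a b, self_mem_nhdsWithin, ?_⟩
    rw [intervalIntegrable_iff_integrableOn_Icc_of_le hab.le] at hBψ
    exact hBψ.aestronglyMeasurable
  have hd := (intervalIntegral.integral_hasDerivWithinAt_left
    (s := Icc a b) (t := Icc a b) hBψt hmeas hc).const_add (-q)
  exact hd.congr hint (hint t ht)

end AdjointEquation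

/-! ### First-order condition and multipliers at a local minimizer. -/

namespace MayerProblem

variable {n m : ℕ} {E I : Type*} {P : MayerProblem n m E I} {w h : VelCtrl n m}

variable (P) in
/-- Variations of `w` whose control component vanishes except where the control stays at a
positive distance from the complement of `V`. -/
def interiorVariations (w : VelCtrl n m) : Submodule ℝ P.pcPairs where
  carrier := {h | ∃ ρ > 0, ∀ t ∈ Icc P.t₀ P.T, h.1.2 t ≠ 0 → Metric.ball (w.2 t) ρ ⊆ P.V}
  zero_mem' := ⟨1, one_pos, fun t _ h => absurd rfl h⟩
  add_mem' := by
    rintro h h' ⟨ρ, hρ, h1⟩ ⟨ρ', hρ', h2⟩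
    refine ⟨min ρ ρ', lt_min hρ hρ', fun t ht hne => ?_⟩
    by_cases h0 : h.1.2 t = 0
    · have h3 : h'.1.2 t ≠ 0 := fun h0' => hne (by
        simp only [Submodule.coe_add, Prod.snd_add, Pi.add_apply, h0, h0', add_zero])
      exact (Metric.ball_subset_ball (min_le_right _ _)).trans (h2 t ht h3)
    · exact (Metric.ball_subset_ball (min_le_left _ _)).trans (h1 t ht h0)
  smul_mem' := by
    rintro c h ⟨ρ, hρ, h1⟩
    refine ⟨ρ, hρ, fun t ht hne => h1 t ht fun h0 => hne ?_⟩
    simp only [SetLike.val_smul, Prod.smul_snd, Pi.smul_apply, h0, smul_zero]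

/-- The variation is bounded and its control part acts only where a ball of fixed radius around the
control lies in `V`, so one small step works at all times. -/
theorem eventually_add_smul_mem_domain (hw : w ∈ P.domain) (h : P.interiorVariations w) {r : ℝ}
    (hr : 0 < r) :
    ∀ᶠ ε : ℝ in 𝓝[>] 0, w + ε • (h : VelCtrl n m) ∈ P.domain ∧ ∀ t ∈ Icc P.t₀ P.T,
      ‖(w + ε • (h : VelCtrl n m)).1 t - w.1 t‖ < r ∧
        ‖(w + ε • (h : VelCtrl n m)).2 t - w.2 t‖ < r := by
  obtain ⟨h, ρ, hρ, hV⟩ := h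
  obtain ⟨-, C, hC⟩ := h.2.1.bddMeas.prodMk h.2.2.bddMeas
  have hlim : Tendsto (fun ε : ℝ => ε * C) (𝓝[>] 0) (𝓝 0) := by
    have : Tendsto (fun ε : ℝ => ε * C) (𝓝 0) (𝓝 (0 * C)) :=
      (continuous_id.mul continuous_const).tendsto 0
    rw [zero_mul] at this
    exact this.mono_left nhdsWithin_le_nhds
  filter_upwards [hlim.eventually (gt_mem_nhds hr), hlim.eventually (gt_mem_nhds hρ),
    self_mem_nhdsWithin] with ε h1 h2 h3
  have h3 : 0 < ε := h3
  have b1 : ∀ t ∈ Icc P.t₀ P.T, ‖ε • h.1.1 t‖ ≤ ε * C := fun t ht => by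
    rw [norm_smul, Real.norm_of_nonneg h3.le]
    exact mul_le_mul_of_nonneg_left ((norm_fst_le (h.1.1 t, h.1.2 t)).trans (hC t ht)) h3.le
  have b2 : ∀ t ∈ Icc P.t₀ P.T, ‖ε • h.1.2 t‖ ≤ ε * C := fun t ht => by
    rw [norm_smul, Real.norm_of_nonneg h3.le]
    exact mul_le_mul_of_nonneg_left ((norm_snd_le (h.1.1 t, h.1.2 t)).trans (hC t ht)) h3.le
  have hpc := P.pcPairs.add_mem (P.domain_subset_pcPairs hw) (P.pcPairs.smul_mem ε h.2)
  refine ⟨⟨hpc.1, hpc.2, fun t ht => ?_⟩, fun t ht => ?_⟩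
  · by_cases h0 : h.1.2 t = 0
    · have : (w + ε • (h : VelCtrl n m)).2 t = w.2 t := by simp [h0]
      rw [this]
      exact hw.2.2 t ht
    · refine hV t ht h0 ?_
      rw [mem_ball_iff_norm]
      simpa using (b2 t ht).trans_lt h2
  · have e1 : (w + ε • (h : VelCtrl n m)).1 t - w.1 t = ε • h.1.1 t := by simp
    have e2 : (w + ε • (h : VelCtrl n m)).2 t - w.2 t = ε • h.1.2 t := by simp
    rw [e1, e2]
    exact ⟨(b1 t ht).trans_lt h1, (b2 t ht).trans_lt h1⟩

namespace Regular

variable [Fintype E] [Fintype I]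

/-- The first order necessary condition for a local minimizer of the penalty function. -/
theorem first_order_condition (hP : P.Regular) (hadm : w ∈ P.admissible) {lam : ℝ}
    (hlam : 0 ≤ lam) (hmin : P.IsLocalMinimizer lam w) (h : P.interiorVariations w) :
    0 ≤ fderiv ℝ (fun y => P.Φ₀ y P.T) (P.traj w.1 P.T) (hP.endpointLin h) +
      lam * (‖hP.defectLin (P.domain_subset_pcPairs hadm.1) h‖ +
        posMax (fun k => fderiv ℝ (fun y => P.ΦE k y P.T) (P.traj w.1 P.T) (hP.endpointLin h))
          ({j | P.ΦI j (P.traj w.1 P.T) P.T = 0}.indicator fun j =>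
            fderiv ℝ (fun y => P.ΦI j y P.T) (P.traj w.1 P.T) (hP.endpointLin h))) := by
  have hpc := P.domain_subset_pcPairs hadm.1
  set a := fderiv ℝ (fun y => P.Φ₀ y P.T) (P.traj w.1 P.T) (hP.endpointLin h)
  set e : E → ℝ := fun k => fderiv ℝ (fun y => P.ΦE k y P.T) (P.traj w.1 P.T) (hP.endpointLin h)
    with he
  set c : I → ℝ := fun j => fderiv ℝ (fun y => P.ΦI j y P.T) (P.traj w.1 P.T) (hP.endpointLin h)
    with hc
  set act : Set I := {j | P.ΦI j (P.traj w.1 P.T) P.T = 0} with hact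
  set θ := posMax e (act.indicator c) with hθ
  have hθ0 : 0 ≤ θ := posMax_nonneg _ _
  set A := hP.defectLin hpc h with hA
  obtain ⟨-, r, hr, hmin⟩ := hmin
  have hJ : HasDerivWithinAt (fun ε : ℝ => P.J (w + ε • (h : VelCtrl n m))) a (Ioi 0) 0 :=
    hP.hasDerivWithinAt_terminal hpc h.1.2 hP.contDiff_Φ₀
  -- Inactive constraints are strictly negative and, being finitely many, remain nonpositive for a
  -- common range of small steps.
  have hinact : ∀ᶠ ε : ℝ in 𝓝[>] 0, ∀ j, j ∉ act → P.ΦI j (P.traj w.1 P.T) P.T + ε * c j ≤ 0 := by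
    rw [eventually_all]
    intro j
    by_cases hj : j ∈ act
    · exact Eventually.of_forall fun _ hj' => absurd hj hj'
    · have hneg : P.ΦI j (P.traj w.1 P.T) P.T < 0 := (hadm.2.2.2 j).lt_of_ne hj
      have hlim : Tendsto (fun ε : ℝ => P.ΦI j (P.traj w.1 P.T) P.T + ε * c j) (𝓝[>] 0)
          (𝓝 (P.ΦI j (P.traj w.1 P.T) P.T + 0 * c j)) :=
        ((continuous_const.add (continuous_id.mul continuous_const)).tendsto 0).mono_left
          nhdsWithin_le_nhds
      rw [zero_mul, add_zero] at hlim
      exact (hlim.eventually (gt_mem_nhds hneg)).mono fun _ h _ => h.le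
  -- The error `(1 + lam) * η` collects `η` from the cost and `lam * η` from the penalty.
  have hmain : ∀ η > 0, 0 ≤ a + lam * (‖A‖ + θ) + (1 + lam) * η := by
    intro η hη
    rw [hasDerivWithinAt_iff_isLittleO, Asymptotics.isLittleO_iff] at hJ
    obtain ⟨ε, hε, hdom, h1, h2, h3⟩ := ((eventually_mem_nhdsWithin (a := (0 : ℝ)) (s := Ioi 0)).and
      ((eventually_add_smul_mem_domain hadm.1 h hr).and ((hJ hη).and
        ((hP.eventually_abs_phi_sub_le hpc h.1 hη).and hinact)))).exists
    have hε : 0 < ε := hε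
    simp only [zero_smul, add_zero, sub_zero, Real.norm_eq_abs, smul_eq_mul, abs_of_pos hε] at h1
    have h4 := hmin _ hdom.1 hdom.2
    simp only [F, hP.phi_eq_zero_of_mem_admissible hadm, mul_zero, add_zero] at h4
    have h5 : penaltyNorm (P.penaltyState w + ε • hP.penaltyLin hpc h) ≤ ε * (‖A‖ + θ) := by
      have hd : toL2 P.t₀ P.T (P.defect w) = 0 := by
        have h6 := hP.phi_eq_zero_of_mem_admissible hadm
        rw [phi, hP.phiDiff_eq_norm hpc] at h6
        have h7 : 0 ≤ P.phiTerm w := posMax_nonneg _ _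
        rw [← norm_eq_zero]
        linarith [norm_nonneg (toL2 P.t₀ P.T (P.defect w))]
      rw [mul_add]
      refine add_le_add (le_of_eq ?_) (posMax_le_iff.2 ⟨by positivity, fun k => ?_, fun j => ?_⟩)
      · change ‖toL2 P.t₀ P.T (P.defect w) + ε • A‖ = _
        rw [hd, zero_add, norm_smul, Real.norm_of_nonneg hε.le]
      · change |P.ΦE k (P.traj w.1 P.T) P.T + ε * e k| ≤ _
        rw [hadm.2.2.1 k, zero_add, abs_mul, abs_of_pos hε]
        exact mul_le_mul_of_nonneg_left (abs_le_posMax e _ k) hε.le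
      · change P.ΦI j (P.traj w.1 P.T) P.T + ε * c j ≤ _
        by_cases hj : j ∈ act
        · have h8 : P.ΦI j (P.traj w.1 P.T) P.T = 0 := hj
          rw [h8, zero_add]
          refine mul_le_mul_of_nonneg_left ?_ hε.le
          have h9 := le_posMax e (act.indicator c) j
          rwa [indicator_of_mem hj] at h9
        · exact (h3 j hj).trans (by positivity)
    have h6 := (abs_le.1 h1).2
    have h7 := (abs_le.1 h2).2
    have h8 : P.phi (w + ε • (h : VelCtrl n m)) ≤ ε * (‖A‖ + θ) + η * ε := by linarith
    have h9 := mul_le_mul_of_nonneg_left h8 hlam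
    have h10 : 0 ≤ ε * (a + lam * (‖A‖ + θ) + (1 + lam) * η) := by linarith
    exact nonneg_of_mul_nonneg_right h10 hε
  refine le_of_forall_pos_le_add fun η hη => ?_
  have h1 := hmain (η / (1 + lam)) (by positivity)
  rwa [mul_div_cancel₀ _ (by positivity)] at h1

theorem inner_gradient {f : Vec n → ℝ} (x y : Vec n) :
    inner ℝ (gradient f x) y = fderiv ℝ f x y := by
  rw [gradient, InnerProductSpace.toDual_symm_apply]

/-- Multipliers for a local minimizer of the penalty function, with the weak form of the adjoint
equation and of the stationarity condition. -/
theorem exists_weak_multipliers (hP : P.Regular) (hadm : w ∈ P.admissible) {lam : ℝ}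
    (hlam : 0 ≤ lam) (hmin : P.IsLocalMinimizer lam w) :
    ∃ (σ : Lp (Vec n) 2 (volume.restrict (Icc P.t₀ P.T))) (ν : E → ℝ) (μ : I → ℝ),
      ‖σ‖ ≤ lam ∧ (∀ k, |ν k| ≤ lam) ∧
      (∀ j, 0 ≤ μ j ∧ μ j ≤ lam ∧ μ j * P.ΦI j (P.traj w.1 P.T) P.T = 0) ∧
      ∀ h : P.interiorVariations w, (∫ t in P.t₀..P.T, inner ℝ (σ t) (P.linDefect w h t)) +
        inner ℝ (gradient (fun y => P.Φ₀ y P.T) (P.traj w.1 P.T)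
          + ∑ k, ν k • gradient (fun y => P.ΦE k y P.T) (P.traj w.1 P.T)
          + ∑ j, μ j • gradient (fun y => P.ΦI j y P.T) (P.traj w.1 P.T))
          (∫ τ in P.t₀..P.T, (h : VelCtrl n m).1 τ) = 0 := by
  have hpc := P.domain_subset_pcPairs hadm.1
  let inc := (P.interiorVariations w).subtype
  obtain ⟨σ, ν, μ, hσ, hν, hμ, hμ0, heq⟩ := exists_multipliers ((hP.defectLin hpc).comp inc)
    (((fderiv ℝ (fun y => P.Φ₀ y P.T) (P.traj w.1 P.T) : Vec n →ₗ[ℝ] ℝ).comp hP.endpointLin).comp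
      inc)
    ((LinearMap.pi fun k =>
      (fderiv ℝ (fun y => P.ΦE k y P.T) (P.traj w.1 P.T) : Vec n →ₗ[ℝ] ℝ).comp
        hP.endpointLin).comp inc)
    ((LinearMap.pi fun j =>
      (fderiv ℝ (fun y => P.ΦI j y P.T) (P.traj w.1 P.T) : Vec n →ₗ[ℝ] ℝ).comp
        hP.endpointLin).comp inc)
    {j | P.ΦI j (P.traj w.1 P.T) P.T = 0} hlam
    (fun h => hP.first_order_condition hadm hlam hmin h)
  refine ⟨σ, ν, μ, hσ, hν, fun j => ⟨(hμ j).1, (hμ j).2, ?_⟩, fun h => ?_⟩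
  · by_cases hj : P.ΦI j (P.traj w.1 P.T) P.T = 0
    · rw [hj, mul_zero]
    · rw [hμ0 j hj, zero_mul]
  · rw [inner_add_left, inner_add_left, sum_inner, sum_inner, inner_gradient]
    simp only [real_inner_smul_left, inner_gradient]
    rw [← inner_toL2 hP.t₀_lt_T.le (Lp.memLp σ) ((hP.bddMeas_linDefect hpc h.1.2).memLp 2),
      toL2_coeFn]
    have h1 := heq h
    change fderiv ℝ (fun y => P.Φ₀ y P.T) (P.traj w.1 P.T) (∫ τ in P.t₀..P.T, h.1.1.1 τ) +
      inner ℝ σ (hP.defectLin hpc h) + ∑ k, ν k * fderiv ℝ (fun y => P.ΦE k y P.T)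
        (P.traj w.1 P.T) (∫ τ in P.t₀..P.T, h.1.1.1 τ) + ∑ j, μ j * fderiv ℝ
          (fun y => P.ΦI j y P.T) (P.traj w.1 P.T) (∫ τ in P.t₀..P.T, h.1.1.1 τ) = 0 at h1
    change inner ℝ σ (hP.defectLin hpc h) + _ = 0
    linarith

end Regular

end MayerProblem

/-! ### Pointwise adjoint equation, stationarity and transversality. -/

namespace MayerProblem

variable {n m : ℕ} {E I : Type*} {P : MayerProblem n m E I} {w : VelCtrl n m}

theorem continuousWithinAt_state {F : Type*} [TopologicalSpace F] (hP : P.Regular)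
    (hw : w ∈ P.pcPairs) {G : Vec n × Vec m × ℝ → F} (hG : Continuous G) {t : ℝ}
    (ht : t ∈ Icc P.t₀ P.T) (hu : ContinuousWithinAt w.2 (Icc P.t₀ P.T) t) :
    ContinuousWithinAt (fun t => G (P.traj w.1 t, w.2 t, t)) (Icc P.t₀ P.T) t :=
  hG.continuousAt.comp_continuousWithinAt
    ((hP.continuousOn_traj hw t ht).prodMk (hu.prodMk continuousWithinAt_id))

/-- The weak stationarity condition in the control holds pointwise at the continuity points of the
control at which its value is interior to `V`. -/
theorem adjoint_fu_apply_eq_zero (hP : P.Regular) (hw : w ∈ P.pcPairs) {ψ : ℝ → Vec n}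
    (hψ : ContinuousOn ψ (Icc P.t₀ P.T))
    (hweak : ∀ h : P.interiorVariations w, (h : VelCtrl n m).1 = 0 →
      ∫ t in P.t₀..P.T, inner ℝ (ψ t) (P.fu (P.traj w.1 t) (w.2 t) t ((h : VelCtrl n m).2 t)) = 0)
    {t : ℝ} (ht : t ∈ Icc P.t₀ P.T) (hu : ContinuousWithinAt w.2 (Icc P.t₀ P.T) t)
    (hint : w.2 t ∈ interior P.V) :
    ContinuousLinearMap.adjoint (P.fu (P.traj w.1 t) (w.2 t) t) (ψ t) = 0 := by
  by_contra hne
  set v := ContinuousLinearMap.adjoint (P.fu (P.traj w.1 t) (w.2 t) t) (ψ t) with hv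
  -- For this choice of `v`, the value of `β` at `t` is `‖v‖ ^ 2`, so a bump at `t` times `v` would
  -- violate the weak identity.
  set β : ℝ → ℝ := fun τ => inner ℝ (ψ τ) (P.fu (P.traj w.1 τ) (w.2 τ) τ v) with hβ
  have hab := hP.t₀_lt_T
  have hβt : 0 < β t := by
    simp only [hβ]
    rw [← ContinuousLinearMap.adjoint_inner_left, ← hv, real_inner_self_eq_norm_sq]
    have := norm_pos_iff.2 hne
    positivity
  have hβc : ContinuousWithinAt β (Icc P.t₀ P.T) t :=
    ContinuousWithinAt.inner (𝕜 := ℝ) (hψ t ht) ((continuousWithinAt_state hP hw hP.continuous_fu ht hu).clm_apply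
      continuousWithinAt_const)
  obtain ⟨ρ, hρ, hball⟩ := Metric.isOpen_iff.1 isOpen_interior _ hint
  obtain ⟨d, hd, hdβ⟩ := Metric.mem_nhdsWithin_iff.1
    ((hβc.eventually (lt_mem_nhds (half_lt_self hβt))).and
      (hu.eventually (Metric.ball_mem_nhds _ (half_pos hρ))))
  -- A tent supported where `β` exceeds half its value at `t` and the control stays within `ρ / 2`
  -- of `w.2 t`; its integral is positive even if `t` is an endpoint.
  set φ : ℝ → ℝ := fun τ => max 0 (d - |τ - t|) with hφ
  have hφc : Continuous φ := by fun_prop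
  have hφ0 : ∀ τ, 0 ≤ φ τ := fun τ => le_max_left _ _
  have hφd : ∀ τ, φ τ ≠ 0 → τ ∈ Metric.ball t d := fun τ h => by
    rw [Metric.mem_ball, Real.dist_eq]
    by_contra! hle
    exact h (max_eq_left (by linarith))
  have hmem : ((0, fun τ => φ τ • v) : VelCtrl n m) ∈ P.pcPairs :=
    ⟨continuous_zero.piecewiseContinuous _ _, (hφc.smul continuous_const).piecewiseContinuous _ _⟩
  have hvar : (⟨_, hmem⟩ : P.pcPairs) ∈ P.interiorVariations w := by
    refine ⟨ρ / 2, half_pos hρ, fun τ hτ hτne => ?_⟩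
    have h1 : φ τ ≠ 0 := fun h0 => hτne (by simp only [h0, zero_smul])
    have h2 := (hdβ ⟨hφd τ h1, hτ⟩).2
    refine subset_trans (fun y hy => ?_) (hball.trans interior_subset)
    rw [Metric.mem_ball] at *
    have := dist_triangle y (w.2 τ) (w.2 t)
    linarith
  have hzero := hweak ⟨_, hvar⟩ rfl
  have hpos : 0 < ∫ τ in P.t₀..P.T, φ τ :=
    intervalIntegral.integral_pos hab hφc.continuousOn (fun τ _ => hφ0 τ)
      ⟨t, ht, by simp [hφ, hd]⟩
  have hβb : BddMeas β P.t₀ P.T := by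
    have h1 := hψ.bddMeas.prodMk (hP.bddMeas_fu hw)
    exact h1.comp_continuous (F := fun p => inner ℝ p.1 (p.2 v)) (by fun_prop)
  have hβi := hβb.intervalIntegrable hP.left_mem hP.right_mem
  have hle : ∫ τ in P.t₀..P.T, φ τ * (β t / 2) ≤ ∫ τ in P.t₀..P.T, φ τ * β τ := by
    refine intervalIntegral.integral_mono_on hab.le
      ((hφc.mul continuous_const).intervalIntegrable _ _)
      (hβi.continuousOn_mul hφc.continuousOn) fun τ hτ => ?_
    by_cases h0 : φ τ = 0
    · simp only [h0, zero_mul, le_refl]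
    · exact mul_le_mul_of_nonneg_left (hdβ ⟨hφd τ h0, hτ⟩).1.le (hφ0 τ)
  have heq : ∫ τ in P.t₀..P.T, φ τ * β τ = 0 := by
    rw [← hzero]
    refine intervalIntegral.integral_congr fun τ _ => ?_
    simp only [hβ, map_smul, inner_smul_right]
  rw [heq, intervalIntegral.integral_mul_const] at hle
  have := mul_pos hpos (half_pos hβt)
  linarith

variable [Fintype E] [Fintype I]

/-- The adjoint equation, stationarity in the control and transversality at a local minimizer of
the penalty function. -/
theorem exists_adjoint_of_isLocalMinimizer (hP : P.Regular) (hadm : w ∈ P.admissible) {lam : ℝ}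
    (hlam : 0 ≤ lam) (hmin : P.IsLocalMinimizer lam w) :
    ∃ (ψ : ℝ → Vec n) (ν : E → ℝ) (μ : I → ℝ),
      ContinuousOn ψ (Icc P.t₀ P.T) ∧
      (∫ t in P.t₀..P.T, ‖ψ t‖ ^ 2) ≤ lam ^ 2 ∧
      (∀ t ∈ Icc P.t₀ P.T, ContinuousWithinAt w.2 (Icc P.t₀ P.T) t →
        HasDerivWithinAt ψ
          (-(ContinuousLinearMap.adjoint (P.fx (P.traj w.1 t) (w.2 t) t)) (ψ t))
          (Icc P.t₀ P.T) t ∧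
        (w.2 t ∈ interior P.V →
          (ContinuousLinearMap.adjoint (P.fu (P.traj w.1 t) (w.2 t) t)) (ψ t) = 0)) ∧
      (∀ k, |ν k| ≤ lam) ∧
      (∀ j, 0 ≤ μ j ∧ μ j ≤ lam ∧ μ j * P.ΦI j (P.traj w.1 P.T) P.T = 0) ∧
      ψ P.T = -gradient (fun y => P.Φ₀ y P.T) (P.traj w.1 P.T)
        - ∑ k, ν k • gradient (fun y => P.ΦE k y P.T) (P.traj w.1 P.T)
        - ∑ j, μ j • gradient (fun y => P.ΦI j y P.T) (P.traj w.1 P.T) := by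
  have hpc := P.domain_subset_pcPairs hadm.1
  have hab := hP.t₀_lt_T
  obtain ⟨σ, ν, μ, hσ, hν, hμ, hweak⟩ := hP.exists_weak_multipliers hadm hlam hmin
  obtain ⟨ψ, hψc, hae, hψT, hψd⟩ := exists_adjoint_solution hab (hP.bddMeas_fx hpc) (Lp.memLp σ)
    _ (fun φ hφ v => by
      -- Velocity-only variations are always allowed, since they leave the control untouched.
      have hmem : ((fun τ => φ τ • v, 0) : VelCtrl n m) ∈ P.pcPairs :=
        ⟨(hφ.smul continuous_const).piecewiseContinuous _ _,
          continuous_zero.piecewiseContinuous _ _⟩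
      have hvar : (⟨_, hmem⟩ : P.pcPairs) ∈ P.interiorVariations w :=
        ⟨1, one_pos, fun τ _ h => absurd rfl h⟩
      have := hweak ⟨_, hvar⟩
      simpa only [linDefect, Pi.zero_apply, map_zero, add_zero] using this)
  refine ⟨ψ, ν, μ, hψc, ?_, fun t ht hu => ⟨hψd t ht
    (continuousWithinAt_state hP hpc hP.continuous_fx ht hu), fun hint => ?_⟩, hν, hμ, ?_⟩
  · have h1 := pow_le_pow_left₀ (norm_nonneg _) hσ 2
    rw [← toL2_coeFn σ, norm_toL2_sq hab.le (Lp.memLp σ)] at h1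
    refine le_trans (le_of_eq ?_) h1
    refine intervalIntegral.integral_congr_ae ?_
    filter_upwards [(ae_restrict_iff' measurableSet_Icc).1 hae] with τ h2 h3
    rw [uIoc_of_le hab.le] at h3
    rw [h2 (Ioc_subset_Icc_self h3)]
  · refine adjoint_fu_apply_eq_zero hP hpc hψc (fun h h0 => ?_) ht hu hint
    have h1 := hweak h
    simp only [linDefect, h0, Pi.zero_apply, intervalIntegral.integral_zero, map_zero, zero_add,
      zero_sub, inner_zero_right, add_zero, inner_neg_right, intervalIntegral.integral_neg,
      neg_eq_zero] at h1
    rw [← h1]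
    refine intervalIntegral.integral_congr_ae ?_
    filter_upwards [(ae_restrict_iff' measurableSet_Icc).1 hae] with τ h2 h3
    rw [uIoc_of_le hab.le] at h3
    rw [h2 (Ioc_subset_Icc_self h3)]
  · rw [hψT]
    abel

end MayerProblem

/-- Serves the case `lam = 0`, where the bound on ψ forces it to vanish pointwise and not only
almost everywhere. -/
theorem ContinuousOn.eq_zero_of_integral_norm_sq_nonpos {k : ℕ} {a b : ℝ} (hab : a < b)
    {ψ : ℝ → Vec k} (hψ : ContinuousOn ψ (Icc a b)) (h : (∫ t in a..b, ‖ψ t‖ ^ 2) ≤ 0) {t : ℝ}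
    (ht : t ∈ Icc a b) : ψ t = 0 := by
  by_contra hne
  have := norm_pos_iff.2 hne
  have hpos : 0 < ∫ t in a..b, ‖ψ t‖ ^ 2 :=
    intervalIntegral.integral_pos hab (hψ.norm.pow 2) (fun _ _ => by positivity)
      ⟨t, ht, by positivity⟩
  linarith

end

theorem mainTheorem1 {n m : ℕ} {E I : Type*} [Fintype E] [Fintype I]
    (P : MayerProblem n m E I) (hP : P.Regular)
    (zs : ℝ → Vec n) (us : ℝ → Vec m) (hadm : (zs, us) ∈ P.admissible) :
    -- the separation condition makes the penalty exact and the optimal pair a minimizer of it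
    (Convex ℝ P.V → P.USC → P.CostBoundedBelow → P.PenaltyAttained → P.CostLipschitz →
      P.IsOptimal (zs, us) →
      ∃ lam₁ : ℝ, P.IsExactPenaltyConstant lam₁ ∧ ∀ lam > lam₁,
        P.IsExactPenaltyConstant lam ∧
        (∀ w ∈ P.domain, P.F lam (zs, us) ≤ P.F lam w) ∧ P.IsLocalMinimizer lam (zs, us)) ∧
    -- adjoint equation, stationarity in the control, and transversality at a local minimizer
    (∀ lam : ℝ, 0 ≤ lam → P.IsLocalMinimizer lam (zs, us) →
      ∃ (s ψ : ℝ → Vec n) (ν : E → ℝ) (μ : I → ℝ),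
        ContinuousOn s (Icc P.t₀ P.T) ∧
        (∫ t in P.t₀..P.T, ‖s t‖ ^ 2) ≤ 1 ∧
        (∀ t ∈ Icc P.t₀ P.T, ψ t = lam • s t) ∧
        (∀ t ∈ Icc P.t₀ P.T, ContinuousWithinAt us (Icc P.t₀ P.T) t →
          HasDerivWithinAt ψ
            (-(ContinuousLinearMap.adjoint (P.fx (P.traj zs t) (us t) t)) (ψ t))
            (Icc P.t₀ P.T) t ∧
          (us t ∈ interior P.V →
            (ContinuousLinearMap.adjoint (P.fu (P.traj zs t) (us t) t)) (ψ t) = 0)) ∧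
        (∀ k, |ν k| ≤ lam) ∧
        (∀ j, 0 ≤ μ j ∧ μ j ≤ lam ∧ μ j * P.ΦI j (P.traj zs P.T) P.T = 0) ∧
        ψ P.T = -gradient (fun y => P.Φ₀ y P.T) (P.traj zs P.T)
          - ∑ k, ν k • gradient (fun y => P.ΦE k y P.T) (P.traj zs P.T)
          - ∑ j, μ j • gradient (fun y => P.ΦI j y P.T) (P.traj zs P.T) ∧
        (IsEmpty E → IsEmpty I →
          ψ P.T = -gradient (fun y => P.Φ₀ y P.T) (P.traj zs P.T))) := by
  refine ⟨fun hV husc hbdd hatt hlip hopt =>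
    hP.exists_exactPenaltyConstant hV husc hbdd hatt hlip hopt, fun lam hlam hmin => ?_⟩
  obtain ⟨ψ, ν, μ, hψc, hψn, hψd, hν, hμ, hψT⟩ :=
    MayerProblem.exists_adjoint_of_isLocalMinimizer hP hadm hlam hmin
  -- For `lam = 0` the convention `0⁻¹ = 0` makes this `s` identically zero, consistent with ψ
  -- vanishing on the interval.
  refine ⟨fun t => lam⁻¹ • ψ t, ψ, ν, μ, hψc.const_smul lam⁻¹, ?_, fun t ht => ?_, hψd, hν, hμ, hψT,
    fun hE hI => ?_⟩
  · simp only [norm_smul, mul_pow, intervalIntegral.integral_const_mul, norm_inv,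
      Real.norm_of_nonneg hlam, inv_pow]
    exact (mul_le_mul_of_nonneg_left hψn (by positivity)).trans (inv_mul_le_one)
  · rcases hlam.eq_or_lt with rfl | hpos
    · rw [zero_smul]
      exact hψc.eq_zero_of_integral_norm_sq_nonpos hP.t₀_lt_T (by simpa using hψn) ht
    · rw [smul_inv_smul₀ hpos.ne']
  · rw [hψT, Finset.univ_eq_empty, Finset.univ_eq_empty, Finset.sum_empty, Finset.sum_empty,
      sub_zero, sub_zero]
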